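/- Let $N\ge 1$ be an integer, $s\in(0,1)$, and let $\Omega\subset\mathbb R^N$ be a bounded Lipschitz domain (nonempty; it need not be connected). Let $p:\mathbb R^N\times\mathbb R^N\to\mathbb R$ be continuous and symmetric, $p(x,y)=p(y,x)$, with $1<\inf p\le\sup p<N/s$, and write $\bar p(x)=p(x,x)$. Let $$X=\Big\{u:\mathbb R^N\to\mathbb R\ \text{measurable}:\ \int_{\mathbb R^N}|u|^{\bar p(x)}dx<\infty,\ \int_{\mathbb R^N}\!\int_{\mathbb R^N}\frac{|u(x)-u(y)|^{p(x,y)}}{|x-y|^{N+sp(x,y)}}\,dx\,dy<\infty,\ u=0\ \text{a.e. in } \mathbb R^N\setminus\Omega\Big\},$$ where functions that agree almost everywhere are identified. For $u\in X$ put $$K(u)=\inf\Big\{\lambda>0:\int_{\mathbb R^N}\!\int_{\mathbb R^N}\frac{|u(x)-u(y)|^{p(x,y)}}{\lambda^{p(x,y)}|x-y|^{N+sp(x,y)}}\frac{dx\,dy}{p(x,y)}<1\Big\},\qquad k(u)=\inf\Big\{\lambda>0:\int_\Omega\Big|\frac{u(x)}{\lambda}\Big|^{\bar p(x)}\frac{dx}{\bar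 p(x)}\le1\Big\},$$ $\nabla_s u(x,y)=\dfrac{u(x)-u(y)}{|x-y|^s}$, and $$\Lambda_1=\inf_{v\in X\setminus\{0\}}\frac{K(v)}{k(v)},\qquad S(u)=\frac{\displaystyle\int_{\mathbb R^N}\!\int_{\mathbb R^N}\Big|\frac{\nabla_s u}{K(u)}\Big|^{p(x,y)}\frac{dx\,dy}{|x-y|^N}}{\displaystyle\int_\Omega\Big|\frac{u}{k(u)}\Big|^{\bar p(x)}dx}\quad(u\in X\setminus\{0\}).$$ A number $\Lambda\in\mathbb R$ is called an eigenvalue with eigenfunction $u\in X\setminus\{0\}$ if $$\int_{\mathbb R^N}\!\int_{\mathbb R^N}\Big|\frac{\nabla_s u}{K(u)}\Big|^{p(x,y)-2}\frac{\nabla_s u}{K(u)}\,\nabla_s\varphi\,\frac{dx\,dy}{|x-y|^N}=\Lambda\,S(u)\int_\Omega\Big|\frac{u}{k(u)}\Big|^{\bar p(x)-2}\frac{u}{k(u)}\,\varphi\,dx\qquad\text{for all }\varphi\in X.$$ Then the infimum $\Lambda_1$ is attained on $X\setminus\{0\}$; every minimizer $u\in X\setminus\{0\}$ of $K/k$ is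 an eigenfunction with eigenvalue $\Lambda_1$; and whenever $\Lambda$ is an eigenvalue with eigenfunction $v$, one has $\Lambda=K(v)/k(v)\ge\Lambda_1$. In particular $\Lambda_1$ is the smallest eigenvalue. -/

import Mathlib

open MeasureTheory
open scoped ENNReal RealInnerProductSpace

namespace FracEigen

noncomputable section

/-- `Ω` is a bounded Lipschitz domain of `ℝ^N`: a nonempty bounded open set that, near each of its
boundary points `x₀`, is the part of a ball lying above the graph of a Lipschitz function in the
direction of some unit vector `ν`. The Lipschitz function `γ` is a function of the component
orthogonal to `ν` only, i.e. it is invariant under translations along `ν`.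
Connectedness is not required, so connected and disconnected sets are both covered. -/
structure IsBoundedLipschitzDomain {N : ℕ} (Ω : Set (EuclideanSpace ℝ (Fin N))) : Prop where
  isOpen : IsOpen Ω
  nonempty : Ω.Nonempty
  isBounded : Bornology.IsBounded Ω
  graph : ∀ x₀ ∈ frontier Ω, ∃ ν : EuclideanSpace ℝ (Fin N), ‖ν‖ = 1 ∧
    ∃ (L : NNReal) (γ : EuclideanSpace ℝ (Fin N) → ℝ) (r : ℝ), 0 < r ∧ LipschitzWith L γ ∧
      (∀ (x : EuclideanSpace ℝ (Fin N)) (t : ℝ), γ (x + t • ν) = γ x) ∧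
      ∀ x ∈ Metric.ball x₀ r, x ∈ Ω ↔ γ x < ⟪x, ν⟫

/-- The standing assumptions on the exponent: `p` is continuous and symmetric on `ℝ^N × ℝ^N`, with
`1 < inf p` and `sup p < N / s`. -/
structure IsAdmissibleExponent {N : ℕ} (s : ℝ)
    (p : EuclideanSpace ℝ (Fin N) → EuclideanSpace ℝ (Fin N) → ℝ) : Prop where
  continuous : Continuous fun z : EuclideanSpace ℝ (Fin N) × EuclideanSpace ℝ (Fin N) => p z.1 z.2
  symm : ∀ x y, p x y = p y x
  one_lt_inf : ∃ a : ℝ, 1 < a ∧ ∀ x y, a ≤ p x y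
  sup_lt : ∃ b : ℝ, b < (N : ℝ) / s ∧ ∀ x y, p x y ≤ b

variable {N : ℕ} (s : ℝ) (p : EuclideanSpace ℝ (Fin N) → EuclideanSpace ℝ (Fin N) → ℝ)
  (Ω : Set (EuclideanSpace ℝ (Fin N)))

/-- The energy `∬ |u(x) - u(y)|^{p(x,y)} / |x-y|^{N + s p(x,y)} dx dy`, as an extended number. -/
def energy (u : EuclideanSpace ℝ (Fin N) → ℝ) : ℝ≥0∞ :=
  ∫⁻ z : EuclideanSpace ℝ (Fin N) × EuclideanSpace ℝ (Fin N),
    ENNReal.ofReal (|u z.1 - u z.2| ^ p z.1 z.2 / ‖z.1 - z.2‖ ^ ((N : ℝ) + s * p z.1 z.2))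

/-- The modular
`ρ(u) = ∬ |u(x) - u(y)|^{p(x,y)} / |x-y|^{N + s p(x,y)} dx dy / p(x,y)`. -/
def rho (u : EuclideanSpace ℝ (Fin N) → ℝ) : ℝ≥0∞ :=
  ∫⁻ z : EuclideanSpace ℝ (Fin N) × EuclideanSpace ℝ (Fin N),
    ENNReal.ofReal
      (|u z.1 - u z.2| ^ p z.1 z.2 / ‖z.1 - z.2‖ ^ ((N : ℝ) + s * p z.1 z.2) / p z.1 z.2)

/-- The space `X`: measurable functions `u` with `∫ |u|^{p(x,x)} dx < ∞` and finite energy on the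
whole space, that vanish (almost everywhere) outside `Ω`. Functions are identified when they agree
almost everywhere; every notion below is invariant under this identification. -/
def X : Set (EuclideanSpace ℝ (Fin N) → ℝ) :=
  {u | AEMeasurable u volume ∧
    (∫⁻ x, ENNReal.ofReal (|u x| ^ p x x)) < ∞ ∧
    energy s p u < ∞ ∧
    ∀ᵐ x ∂(volume : Measure (EuclideanSpace ℝ (Fin N))), x ∉ Ω → u x = 0}

/-- `u` is not the zero element of `X`. -/
def Nontriv (u : EuclideanSpace ℝ (Fin N) → ℝ) : Prop :=
  ¬ u =ᵐ[volume] 0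

/-- The Luxemburg seminorm `K(u) = inf {λ > 0 : ρ(u/λ) < 1}`. -/
def K (u : EuclideanSpace ℝ (Fin N) → ℝ) : ℝ :=
  sInf {l : ℝ | 0 < l ∧ rho s p (fun x => u x / l) < 1}

/-- The Luxemburg norm
`k(u) = inf {λ > 0 : ∫_Ω |u(x)/λ|^{p(x,x)} dx / p(x,x) ≤ 1}`. -/
def k (u : EuclideanSpace ℝ (Fin N) → ℝ) : ℝ :=
  sInf {l : ℝ | 0 < l ∧ (∫⁻ x in Ω, ENNReal.ofReal (|u x / l| ^ p x x / p x x)) ≤ 1}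

/-- The homogeneous Rayleigh quotient. -/
def H (u : EuclideanSpace ℝ (Fin N) → ℝ) : ℝ := K s p u / k p Ω u

/-- `Λ₁`, the infimum of the homogeneous Rayleigh quotient over `X \ {0}`. -/
def Lambda1 : ℝ := sInf (H s p Ω '' {v | v ∈ X s p Ω ∧ Nontriv v})

/-- `u` is a (nontrivial) minimizer of `Λ₁`. -/
def IsMinimizer (u : EuclideanSpace ℝ (Fin N) → ℝ) : Prop :=
  u ∈ X s p Ω ∧ Nontriv u ∧ H s p Ω u = Lambda1 s p Ω

/-- The fractional difference quotient `(∇ₛ u)(x,y) = (u(x) - u(y)) / |x-y|^s`. -/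
def grad (u : EuclideanSpace ℝ (Fin N) → ℝ)
    (z : EuclideanSpace ℝ (Fin N) × EuclideanSpace ℝ (Fin N)) : ℝ :=
  (u z.1 - u z.2) / ‖z.1 - z.2‖ ^ s

/-- The factor `S(u)`. -/
def S (u : EuclideanSpace ℝ (Fin N) → ℝ) : ℝ :=
  (∫ z : EuclideanSpace ℝ (Fin N) × EuclideanSpace ℝ (Fin N),
      |grad s u z / K s p u| ^ p z.1 z.2 / ‖z.1 - z.2‖ ^ (N : ℝ)) /
    ∫ x in Ω, |u x / k p Ω u| ^ p x x

/-- `u ∈ X` is an eigenfunction for `Λ`: it is nontrivial and satisfies the weak equation against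
every test function `φ ∈ X`. -/
structure IsEigenpair (Λ : ℝ) (u : EuclideanSpace ℝ (Fin N) → ℝ) : Prop where
  mem : u ∈ X s p Ω
  nontriv : Nontriv u
  weak : ∀ φ ∈ X s p Ω,
    (∫ z : EuclideanSpace ℝ (Fin N) × EuclideanSpace ℝ (Fin N),
      |grad s u z / K s p u| ^ (p z.1 z.2 - 2) * (grad s u z / K s p u) * grad s φ z
        / ‖z.1 - z.2‖ ^ (N : ℝ)) =
    Λ * S s p Ω u *
      ∫ x in Ω, |u x / k p Ω u| ^ (p x x - 2) * (u x / k p Ω u) * φ x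

/-- `Λ` is an eigenvalue. -/
def IsEigenvalue (Λ : ℝ) : Prop := ∃ u, IsEigenpair s p Ω Λ u

end

end FracEigen

/-! `K` and `k` are Luxemburg norms for two modulars `∫ |g|^q / q`: the first of `∇ₛu` for the
measure `dx dy / |x - y|^N`, the second of `u` on `Ω`. Dividing a nontrivial element by its norm
makes the modular exactly 1 (`modular_div_sInf`). Hence `Λ₁ k ≤ K` can be read in modular form: if
`Λ₁ v` has modular above 1 on `Ω`, then `∇ₛv` has modular at least 1 (`one_le_modular_grad`).

The equation comes from this implication, without differentiating `K` or `k`. For a minimizer `u`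
put `w = u / K(u)`, so that `Λ₁ w = u / k(u)` and both modulars equal 1. The modulars are
differentiable along lines (`hasDerivAt_modular`), so a direction that increases the second to first
order cannot decrease the first to first order. Two linear forms related in this way, and both
positive at `w`, are proportional; the factor is `S(u)`. Conversely, testing the equation of any
eigenpair with its own eigenfunction gives `Λ = K / k`, which is at least `Λ₁`.

Existence is the direct method for a minimizing sequence with `k = 1`. Two facts replace a compact
embedding theorem, and both come from comparing `u(x)` with its values on a small ball through the
energy density at `x`. Averages over balls approximate `u` in `L¹` uniformly along the sequence,
which gives an almost everywhere convergent subsequence (`exists_subseq_tendsto_ae`). Optimizing the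
radius pointwise bounds `|u|^(p(x,x) + η)` in `L¹` (`exists_gain`), so no mass of the modular on `Ω`
is lost in the limit (`one_le_modular_of_tendsto`). Fatou's lemma handles the energy
(`modular_le_of_tendsto`). A cone supported in a ball shows that there are competitors. -/

namespace FracEigen

/-! ### Modulars with variable exponent: scaling, Luxemburg norms, differentiability. -/

section Modular

variable {α : Type*} [MeasurableSpace α] {μ : Measure α} {q g h : α → ℝ} {a b : ℝ}

/-- The modular `∫ |g|^q / q dμ` of the variable exponent Lebesgue space. -/
noncomputable def modular (μ : Measure α) (q g : α → ℝ) : ℝ≥0∞ :=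
  ∫⁻ x, ENNReal.ofReal (|g x| ^ q x / q x) ∂μ

/-- The exponent `q` is measurable with values in `[a, b]`, where `1 < a`. -/
structure ExponentBounds (q : α → ℝ) (a b : ℝ) : Prop where
  measurable : Measurable q
  one_lt : 1 < a
  le : ∀ x, a ≤ q x
  ge : ∀ x, q x ≤ b

theorem ExponentBounds.pos (hq : ExponentBounds q a b) (x : α) : 0 < q x := by
  linarith [hq.one_lt, hq.le x]

theorem modular_le_mul_of_abs_le {c A : ℝ} (hA : 0 ≤ A) (hq : ∀ x, 0 < q x)
    (hgh : ∀ x, |g x| = c * |h x|) (hc : 0 ≤ c) (hcA : ∀ x, c ^ q x ≤ A) :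
    modular μ q g ≤ ENNReal.ofReal A * modular μ q h := by
  unfold modular
  rw [← lintegral_const_mul' _ _ ENNReal.ofReal_ne_top]
  refine lintegral_mono fun x => ?_
  rw [← ENNReal.ofReal_mul hA]
  apply ENNReal.ofReal_le_ofReal
  rw [hgh x, Real.mul_rpow hc (abs_nonneg _), mul_div_assoc]
  exact mul_le_mul_of_nonneg_right (hcA x)
    (div_nonneg (Real.rpow_nonneg (abs_nonneg _) _) (hq x).le)

theorem modular_div_le_of_le (hq : ExponentBounds q a b) {l l' : ℝ} (hl : 0 < l) (hll : l ≤ l') :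
    modular μ q (fun x => g x / l') ≤
      ENNReal.ofReal ((l / l') ^ a) * modular μ q (fun x => g x / l) := by
  have hl' : 0 < l' := hl.trans_le hll
  refine modular_le_mul_of_abs_le (c := l / l') (by positivity) hq.pos (fun x => ?_)
    (by positivity) (fun x => ?_)
  · rw [abs_div, abs_div, abs_of_pos hl, abs_of_pos hl']
    field_simp
  · exact Real.rpow_le_rpow_of_exponent_ge (by positivity) ((div_le_one hl').2 hll) (hq.le x)

theorem modular_div_le_of_ge (hq : ExponentBounds q a b) {l l' : ℝ} (hl : 0 < l) (hll : l ≤ l') :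
    modular μ q (fun x => g x / l) ≤
      ENNReal.ofReal ((l' / l) ^ b) * modular μ q (fun x => g x / l') := by
  have hl' : 0 < l' := hl.trans_le hll
  refine modular_le_mul_of_abs_le (c := l' / l) (by positivity) hq.pos (fun x => ?_)
    (by positivity) (fun x => ?_)
  · rw [abs_div, abs_div, abs_of_pos hl, abs_of_pos hl']
    field_simp
  · exact Real.rpow_le_rpow_of_exponent_le ((one_le_div hl).2 hll) (hq.ge x)

theorem modular_div_anti (hq : ExponentBounds q a b) {l l' : ℝ} (hl : 0 < l) (hll : l ≤ l') :
    modular μ q (fun x => g x / l') ≤ modular μ q (fun x => g x / l) := by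
  have hl' : 0 < l' := hl.trans_le hll
  refine (modular_div_le_of_le hq hl hll).trans ?_
  refine (mul_le_mul_left (ENNReal.ofReal_le_one.2 ?_) _).trans_eq (one_mul _)
  exact Real.rpow_le_one (by positivity) ((div_le_one hl').2 hll) (by linarith [hq.one_lt])

theorem modular_div_ne_top (hq : ExponentBounds q a b) {l : ℝ} (hl : 0 < l)
    (hg : modular μ q g ≠ ∞) : modular μ q (fun x => g x / l) ≠ ∞ := by
  have h1 : modular μ q (fun x => g x / 1) ≠ ∞ := by simpa using hg
  rcases le_total l 1 with h | h
  · exact ne_top_of_le_ne_top (ENNReal.mul_ne_top ENNReal.ofReal_ne_top h1)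
      (modular_div_le_of_ge hq hl h)
  · exact ne_top_of_le_ne_top h1 (modular_div_anti hq one_pos h)

theorem modular_ne_top_of_div (hq : ExponentBounds q a b) {l : ℝ} (hl : 0 < l)
    (hg : modular μ q (fun x => g x / l) ≠ ∞) : modular μ q g ≠ ∞ := by
  have := modular_div_ne_top hq (l := l⁻¹) (by positivity) hg
  convert this using 3
  field_simp

/-- The Luxemburg norm `sInf T` normalizes the modular, whether it is defined by strict or by weak
inequalities. -/
theorem modular_div_sInf (hq : ExponentBounds q a b) {T : Set ℝ}
    (hT : ∀ l ∈ T, 0 < l ∧ modular μ q (fun x => g x / l) ≤ 1)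
    (hT' : ∀ l, 0 < l → modular μ q (fun x => g x / l) < 1 → l ∈ T)
    (h0 : modular μ q g ≠ 0) (htop : modular μ q g ≠ ∞) :
    0 < sInf T ∧ modular μ q (fun x => g x / sInf T) = 1 := by
  set m := (modular μ q g).toReal with hm
  have hm0 : 0 < m := ENNReal.toReal_pos h0 htop
  have hM : modular μ q g = ENNReal.ofReal m := (ENNReal.ofReal_toReal htop).symm
  have hM1 : modular μ q (fun x => g x / 1) = ENNReal.ofReal m := by simpa using hM
  have hne : T.Nonempty := by
    -- At `l = 1 + m` the modular is at most `m / (1 + m)^a ≤ m / (1 + m) < 1`.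
    refine ⟨1 + m, hT' _ (by positivity) ?_⟩
    refine (modular_div_le_of_le hq one_pos (by linarith)).trans_lt ?_
    rw [hM1, ← ENNReal.ofReal_mul (by positivity), ENNReal.ofReal_lt_one]
    have h1 : (1 / (1 + m)) ^ a ≤ 1 / (1 + m) := by
      refine (Real.rpow_le_rpow_of_exponent_ge (by positivity) ?_ hq.one_lt.le).trans_eq
        (Real.rpow_one _)
      rw [div_le_one (by positivity)]
      linarith
    calc (1 / (1 + m)) ^ a * m ≤ 1 / (1 + m) * m := by gcongr
      _ < 1 := by rw [one_div_mul_eq_div, div_lt_one (by positivity)]; linarith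
  have hlow : ∀ l ∈ T, min 1 m ≤ l := by
    intro l hl
    obtain ⟨hl0, hl1⟩ := hT l hl
    rcases le_total 1 l with h | h
    · exact (min_le_left _ _).trans h
    · refine (min_le_right _ _).trans ?_
      have h2 := modular_div_le_of_le (μ := μ) (g := g) hq hl0 h
      rw [hM1] at h2
      have h3 : ENNReal.ofReal m ≤ ENNReal.ofReal ((l / 1) ^ a) :=
        h2.trans ((mul_le_mul_right hl1 _).trans_eq (mul_one _))
      rw [ENNReal.ofReal_le_ofReal_iff (by positivity), div_one] at h3
      exact h3.trans ((Real.rpow_le_rpow_of_exponent_ge hl0 h hq.one_lt.le).trans_eq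
        (Real.rpow_one _))
  have hpos : 0 < sInf T := (lt_min one_pos hm0).trans_le (le_csInf hne hlow)
  have hbdd : BddBelow T := ⟨_, hlow⟩
  refine ⟨hpos, ?_⟩
  set n := sInf T with hn
  -- The modular at `n` is compared with those at `n * t` (at most 1) and at `n / t` (at least 1)
  -- for `t > 1`. Each comparison costs a factor `t ^ b`, which tends to 1 as `t` decreases to 1.
  have hlim : Filter.Tendsto (fun t : ℝ => ENNReal.ofReal (t ^ b)) (nhdsWithin 1 (Set.Ioi 1))
      (nhds 1) := by
    have : ContinuousAt (fun t : ℝ => ENNReal.ofReal (t ^ b)) 1 :=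
      ENNReal.continuous_ofReal.continuousAt.comp
        (Real.continuousAt_rpow_const _ _ (Or.inl one_ne_zero))
    have h := this.tendsto
    simp only [Real.one_rpow, ENNReal.ofReal_one] at h
    exact h.mono_left nhdsWithin_le_nhds
  apply le_antisymm
  · refine ge_of_tendsto hlim ?_
    filter_upwards [self_mem_nhdsWithin] with t ht
    have ht : (1 : ℝ) < t := ht
    have hnt : n < n * t := by nlinarith
    obtain ⟨l, hl, hlt⟩ := exists_lt_of_csInf_lt hne hnt
    have h1 := (modular_div_anti hq (hT l hl).1 hlt.le).trans (hT l hl).2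
    refine (modular_div_le_of_ge hq hpos hnt.le).trans ?_
    rw [mul_div_cancel_left₀ _ hpos.ne']
    exact (mul_le_mul_right h1 _).trans_eq (mul_one _)
  · have hlim2 : Filter.Tendsto (fun t : ℝ => ENNReal.ofReal (t ^ b) *
        modular μ q (fun x => g x / n)) (nhdsWithin 1 (Set.Ioi 1))
        (nhds (1 * modular μ q (fun x => g x / n))) :=
      ENNReal.Tendsto.mul_const hlim (Or.inl one_ne_zero)
    rw [one_mul] at hlim2
    refine ge_of_tendsto hlim2 ?_
    filter_upwards [self_mem_nhdsWithin] with t ht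
    have ht : (1 : ℝ) < t := ht
    have ht0 : 0 < t := by linarith
    have hnt : n / t < n := by rw [div_lt_iff₀ ht0]; nlinarith
    have h1 : 1 ≤ modular μ q (fun x => g x / (n / t)) := by
      by_contra! hcon
      exact absurd (csInf_le hbdd (hT' _ (by positivity) hcon)) (not_le.2 hnt)
    refine h1.trans ((modular_div_le_of_ge hq (by positivity) hnt.le).trans_eq ?_)
    rw [div_div_cancel₀ hpos.ne']

theorem abs_add_rpow_le {x y r B : ℝ} (hr : 0 ≤ r) (hB : r ≤ B) :
    |x + y| ^ r ≤ 2 ^ B * (|x| ^ r + |y| ^ r) := by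
  have hx := Real.rpow_nonneg (abs_nonneg x) r
  have hy := Real.rpow_nonneg (abs_nonneg y) r
  have h1 : |x + y| ≤ 2 * max |x| |y| := by
    have := abs_add_le x y
    have := le_max_left |x| |y|
    have := le_max_right |x| |y|
    linarith
  have h2 : (max |x| |y|) ^ r ≤ |x| ^ r + |y| ^ r := by
    rcases max_cases |x| |y| with ⟨h, -⟩ | ⟨h, -⟩ <;> rw [h] <;> linarith
  calc |x + y| ^ r ≤ (2 * max |x| |y|) ^ r := Real.rpow_le_rpow (abs_nonneg _) h1 hr
    _ = 2 ^ r * (max |x| |y|) ^ r :=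
      Real.mul_rpow (by norm_num) ((abs_nonneg _).trans (le_max_left _ _))
    _ ≤ 2 ^ B * (|x| ^ r + |y| ^ r) := by
      gcongr
      norm_num

theorem aemeasurable_abs_rpow (hq : Measurable q) (hg : AEMeasurable g μ) :
    AEMeasurable (fun x => |g x| ^ q x) μ :=
  (measurable_norm.comp_aemeasurable hg).pow hq.aemeasurable

theorem modular_add_ne_top (hq : ExponentBounds q a b) (hg : AEMeasurable g μ)
    (hgt : modular μ q g ≠ ∞) (hht : modular μ q h ≠ ∞) :
    modular μ q (fun x => g x + h x) ≠ ∞ := by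
  have key : modular μ q (fun x => g x + h x) ≤
      ENNReal.ofReal (2 ^ b) * (modular μ q g + modular μ q h) := by
    unfold modular
    rw [← lintegral_add_left', ← lintegral_const_mul' _ _ ENNReal.ofReal_ne_top]
    · refine lintegral_mono fun x => ?_
      have := hq.pos x
      rw [← ENNReal.ofReal_add (by positivity) (by positivity),
        ← ENNReal.ofReal_mul (by positivity)]
      apply ENNReal.ofReal_le_ofReal
      rw [← add_div, ← mul_div_assoc]
      gcongr
      exact abs_add_rpow_le this.le (hq.ge x)
    · exact ((aemeasurable_abs_rpow hq.measurable hg).div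
        hq.measurable.aemeasurable).ennreal_ofReal
  exact ne_top_of_le_ne_top
    (ENNReal.mul_ne_top ENNReal.ofReal_ne_top (ENNReal.add_ne_top.2 ⟨hgt, hht⟩)) key

theorem modular_const_mul_ne_top (hq : ExponentBounds q a b) (c : ℝ)
    (hgt : modular μ q g ≠ ∞) : modular μ q (fun x => c * g x) ≠ ∞ := by
  refine ne_top_of_le_ne_top (ENNReal.mul_ne_top ENNReal.ofReal_ne_top hgt)
    (modular_le_mul_of_abs_le (c := |c|) (A := (1 + |c|) ^ b) (by positivity) hq.pos
      (fun x => abs_mul _ _) (abs_nonneg _) (fun x => ?_))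
  calc |c| ^ q x ≤ (1 + |c|) ^ q x :=
        Real.rpow_le_rpow (abs_nonneg _) (by linarith) (hq.pos x).le
    _ ≤ (1 + |c|) ^ b :=
        Real.rpow_le_rpow_of_exponent_le (by linarith [abs_nonneg c]) (hq.ge x)

theorem modular_le_lintegral (hq : ExponentBounds q a b) :
    modular μ q g ≤ ∫⁻ x, ENNReal.ofReal (|g x| ^ q x) ∂μ := by
  refine lintegral_mono fun x => ENNReal.ofReal_le_ofReal (div_le_self (by positivity) ?_)
  linarith [hq.le x, hq.one_lt]

theorem lintegral_le_modular (hq : ExponentBounds q a b) :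
    ∫⁻ x, ENNReal.ofReal (|g x| ^ q x) ∂μ ≤ ENNReal.ofReal b * modular μ q g := by
  unfold modular
  rw [← lintegral_const_mul' _ _ ENNReal.ofReal_ne_top]
  refine lintegral_mono fun x => ?_
  have h0 := hq.pos x
  have hb := hq.ge x
  rw [← ENNReal.ofReal_mul (by linarith)]
  apply ENNReal.ofReal_le_ofReal
  rw [mul_div_assoc', le_div_iff₀ h0, mul_comm]
  gcongr

theorem lintegral_rpow_ne_top_iff (hq : ExponentBounds q a b) :
    ∫⁻ x, ENNReal.ofReal (|g x| ^ q x) ∂μ ≠ ∞ ↔ modular μ q g ≠ ∞ :=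
  ⟨fun h => ne_top_of_le_ne_top h (modular_le_lintegral hq), fun h =>
    ne_top_of_le_ne_top (ENNReal.mul_ne_top ENNReal.ofReal_ne_top h) (lintegral_le_modular hq)⟩

theorem integrable_abs_rpow (hq : ExponentBounds q a b) (hg : AEMeasurable g μ)
    (hgt : modular μ q g ≠ ∞) : Integrable (fun x => |g x| ^ q x) μ := by
  refine ⟨(aemeasurable_abs_rpow hq.measurable hg).aestronglyMeasurable, ?_⟩
  rw [hasFiniteIntegral_iff_ofReal (Filter.Eventually.of_forall fun x => by positivity)]
  exact ((lintegral_rpow_ne_top_iff hq).2 hgt).lt_top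

theorem integrable_abs_rpow_div (hq : ExponentBounds q a b) (hg : AEMeasurable g μ)
    (hgt : modular μ q g ≠ ∞) : Integrable (fun x => |g x| ^ q x / q x) μ := by
  refine ⟨((aemeasurable_abs_rpow hq.measurable hg).div
    hq.measurable.aemeasurable).aestronglyMeasurable, ?_⟩
  rw [hasFiniteIntegral_iff_ofReal (Filter.Eventually.of_forall fun x => ?_)]
  · exact hgt.lt_top
  · have := hq.pos x
    positivity

theorem ofReal_integral_eq_modular (hq : ExponentBounds q a b) (hg : AEMeasurable g μ)
    (hgt : modular μ q g ≠ ∞) :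
    ENNReal.ofReal (∫ x, |g x| ^ q x / q x ∂μ) = modular μ q g := by
  rw [ofReal_integral_eq_lintegral_ofReal (integrable_abs_rpow_div hq hg hgt)
    (Filter.Eventually.of_forall fun x => ?_)]
  · rfl
  · have := hq.pos x
    show (0 : ℝ) ≤ _
    positivity

theorem integral_abs_rpow_pos (hq : ExponentBounds q a b) (hg : AEMeasurable g μ)
    (hgt : modular μ q g ≠ ∞) (h0 : modular μ q g ≠ 0) : 0 < ∫ x, |g x| ^ q x ∂μ := by
  have h1 : 0 < ∫ x, |g x| ^ q x / q x ∂μ := by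
    rw [← ENNReal.ofReal_pos, ofReal_integral_eq_modular hq hg hgt]
    exact pos_iff_ne_zero.2 h0
  refine h1.trans_le (integral_mono (integrable_abs_rpow_div hq hg hgt)
    (integrable_abs_rpow hq hg hgt) fun x => div_le_self (by positivity) ?_)
  linarith [hq.le x, hq.one_lt]

theorem abs_rpow_sub_two_mul_sq {x r : ℝ} (hr : 0 < r) : |x| ^ (r - 2) * x * x = |x| ^ r := by
  rcases eq_or_ne x 0 with rfl | hx
  · simp [Real.zero_rpow hr.ne']
  · have : 0 < |x| := abs_pos.2 hx
    rw [mul_assoc, ← sq, ← sq_abs, ← Real.rpow_natCast, ← Real.rpow_add this]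
    norm_num

theorem hasDerivAt_abs_rpow_div {r : ℝ} (hr : 1 < r) (x y t : ℝ) :
    HasDerivAt (fun t => |x + t * y| ^ r / r) (|x + t * y| ^ (r - 2) * (x + t * y) * y) t := by
  have h1 : HasDerivAt (fun t => x + t * y) y t := by
    simpa using ((hasDerivAt_id t).mul_const y).const_add x
  have h2 := ((hasDerivAt_abs_rpow (x + t * y) hr).comp t h1).div_const r
  refine h2.congr_deriv ?_
  field_simp

/-- Both `|x + t y|` and `|y|` are at most `|x| + |y|`, so the product is at most `(|x| + |y|)^r`.
The bound does not depend on `t`; it is the majorant for differentiating under the integral. -/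
theorem abs_deriv_abs_rpow_le {r B x y t : ℝ} (hr : 1 < r) (hB : r ≤ B) (ht : |t| ≤ 1) :
    |(|x + t * y| ^ (r - 2) * (x + t * y) * y)| ≤ 2 ^ B * (|x| ^ r + |y| ^ r) := by
  set z := x + t * y with hz
  have h1 : |(|z| ^ (r - 2) * z * y)| = |z| ^ (r - 1) * |y| := by
    rw [abs_mul, abs_mul, abs_of_nonneg (Real.rpow_nonneg (abs_nonneg z) _)]
    congr 1
    rcases eq_or_ne z 0 with h | h
    · rw [h, abs_zero, mul_zero, Real.zero_rpow (by linarith)]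
    · rw [← Real.rpow_add_one (abs_pos.2 h).ne']
      congr 1
      ring
  have h2 : |z| ≤ |x| + |y| := by
    refine (abs_add_le _ _).trans ?_
    rw [abs_mul]
    have := mul_le_mul_of_nonneg_right ht (abs_nonneg y)
    linarith
  have hxy : 0 ≤ |x| + |y| := by positivity
  rw [h1]
  calc |z| ^ (r - 1) * |y| ≤ (|x| + |y|) ^ (r - 1) * (|x| + |y|) := by
        gcongr
        linarith [abs_nonneg x]
    _ = |(|x| + |y|)| ^ r := by
        rw [abs_of_nonneg hxy]
        rcases hxy.eq_or_lt with h | h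
        · rw [← h, mul_zero, Real.zero_rpow (by linarith)]
        · rw [← Real.rpow_add_one h.ne']
          congr 1
          ring
    _ ≤ 2 ^ B * (|x| ^ r + |y| ^ r) := by
        simpa using abs_add_rpow_le (x := |x|) (y := |y|) (by linarith) hB

theorem aestronglyMeasurable_deriv (hq : Measurable q) (hg : AEMeasurable g μ)
    (hh : AEMeasurable h μ) :
    AEStronglyMeasurable (fun x => |g x| ^ (q x - 2) * g x * h x) μ :=
  ((((measurable_norm.comp_aemeasurable hg).pow (hq.sub_const 2).aemeasurable).mul hg).mul
    hh).aestronglyMeasurable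

theorem integrable_deriv (hq : ExponentBounds q a b) (hg : AEMeasurable g μ)
    (hh : AEMeasurable h μ) (hgt : modular μ q g ≠ ∞) (hht : modular μ q h ≠ ∞) :
    Integrable (fun x => |g x| ^ (q x - 2) * g x * h x) μ := by
  refine (((integrable_abs_rpow hq hg hgt).add (integrable_abs_rpow hq hh hht)).const_mul
    (2 ^ b)).mono' (aestronglyMeasurable_deriv hq.measurable hg hh)
    (Filter.Eventually.of_forall fun x => ?_)
  have := abs_deriv_abs_rpow_le (x := g x) (y := h x) (t := 0)
    (hq.one_lt.trans_le (hq.le x)) (hq.ge x) (by simp)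
  simpa using this

theorem hasDerivAt_modular (hq : ExponentBounds q a b) (hg : AEMeasurable g μ)
    (hh : AEMeasurable h μ) (hgt : modular μ q g ≠ ∞) (hht : modular μ q h ≠ ∞) :
    HasDerivAt (fun t : ℝ => ∫ x, |g x + t * h x| ^ q x / q x ∂μ)
      (∫ x, |g x| ^ (q x - 2) * g x * h x ∂μ) 0 := by
  have key := (hasDerivAt_integral_of_dominated_loc_of_deriv_le (μ := μ) (𝕜 := ℝ)
    (F := fun t x => |g x + t * h x| ^ q x / q x)
    (F' := fun t x => |g x + t * h x| ^ (q x - 2) * (g x + t * h x) * h x) (x₀ := 0)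
    (s := Metric.ball 0 1) (bound := fun x => 2 ^ b * (|g x| ^ q x + |h x| ^ q x))
    (Metric.ball_mem_nhds _ one_pos) ?_ ?_ ?_ ?_ ?_ ?_).2
  · simpa using key
  · refine Filter.Eventually.of_forall fun t => ?_
    exact ((aemeasurable_abs_rpow hq.measurable (hg.add (hh.const_mul t))).div
      hq.measurable.aemeasurable).aestronglyMeasurable
  · simpa using integrable_abs_rpow_div hq hg hgt
  · simpa using aestronglyMeasurable_deriv hq.measurable hg hh
  · refine Filter.Eventually.of_forall fun x t ht => ?_
    refine abs_deriv_abs_rpow_le (hq.one_lt.trans_le (hq.le x)) (hq.ge x) ?_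
    simpa using (mem_ball_zero_iff.1 ht).le
  · exact ((integrable_abs_rpow hq hg hgt).add (integrable_abs_rpow hq hh hht)).const_mul _
  · exact Filter.Eventually.of_forall fun x t _ =>
      hasDerivAt_abs_rpow_div (hq.one_lt.trans_le (hq.le x)) _ _ _

end Modular

/-! ### First-order variation of a modular normalized to 1. -/

section Variation

variable {α : Type*} [MeasurableSpace α] {μ : Measure α} {q g h : α → ℝ} {a b : ℝ}

theorem eventually_one_lt_modular (hq : ExponentBounds q a b) (hg : AEMeasurable g μ)
    (hh : AEMeasurable h μ) (hg1 : modular μ q g = 1) (hht : modular μ q h ≠ ∞)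
    (hA : 0 < ∫ x, |g x| ^ (q x - 2) * g x * h x ∂μ) :
    ∀ᶠ t in nhdsWithin (0 : ℝ) (Set.Ioi 0), 1 < modular μ q (fun x => g x + t * h x) := by
  have hgt : modular μ q g ≠ ∞ := by simp [hg1]
  have hd := (hasDerivAt_modular hq hg hh hgt hht).hasDerivWithinAt (s := Set.Ioi 0)
  rw [hasDerivWithinAt_iff_tendsto_slope' (by simp)] at hd
  have h1 : ∫ x, |g x| ^ q x / q x ∂μ = 1 := by
    rw [← ENNReal.ofReal_eq_one, ofReal_integral_eq_modular hq hg hgt, hg1]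
  filter_upwards [hd.eventually (lt_mem_nhds hA), self_mem_nhdsWithin] with t ht ht0
  have ht0 : 0 < t := ht0
  rw [← ofReal_integral_eq_modular hq (g := fun x => g x + t * h x) (hg.add (hh.const_mul t))
    (modular_add_ne_top hq hg hgt (modular_const_mul_ne_top hq t hht)), ENNReal.one_lt_ofReal]
  rw [slope_def_field] at ht
  simp only [zero_mul, add_zero, sub_zero, h1] at ht
  have := (div_pos_iff_of_pos_right ht0).1 ht
  linarith

theorem eventually_modular_lt_one (hq : ExponentBounds q a b) (hg : AEMeasurable g μ)
    (hh : AEMeasurable h μ) (hg1 : modular μ q g = 1) (hht : modular μ q h ≠ ∞)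
    (hA : ∫ x, |g x| ^ (q x - 2) * g x * h x ∂μ < 0) :
    ∀ᶠ t in nhdsWithin (0 : ℝ) (Set.Ioi 0), modular μ q (fun x => g x + t * h x) < 1 := by
  have hgt : modular μ q g ≠ ∞ := by simp [hg1]
  have hd := (hasDerivAt_modular hq hg hh hgt hht).hasDerivWithinAt (s := Set.Ioi 0)
  rw [hasDerivWithinAt_iff_tendsto_slope' (by simp)] at hd
  have h1 : ∫ x, |g x| ^ q x / q x ∂μ = 1 := by
    rw [← ENNReal.ofReal_eq_one, ofReal_integral_eq_modular hq hg hgt, hg1]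
  filter_upwards [hd.eventually (gt_mem_nhds hA), self_mem_nhdsWithin] with t ht ht0
  have ht0 : 0 < t := ht0
  rw [← ofReal_integral_eq_modular hq (g := fun x => g x + t * h x) (hg.add (hh.const_mul t))
    (modular_add_ne_top hq hg hgt (modular_const_mul_ne_top hq t hht)), ENNReal.ofReal_lt_one]
  rw [slope_def_field] at ht
  simp only [zero_mul, add_zero, sub_zero, h1] at ht
  have := (div_lt_iff₀ ht0).1 ht
  linarith

theorem ae_eq_zero_of_modular_eq_zero (hq : ExponentBounds q a b) (hg : AEMeasurable g μ)
    (h0 : modular μ q g = 0) : g =ᵐ[μ] 0 := by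
  have h1 := (lintegral_eq_zero_iff' ((aemeasurable_abs_rpow hq.measurable hg).div
    hq.measurable.aemeasurable).ennreal_ofReal).1 h0
  filter_upwards [h1] with x hx
  have hqx := hq.pos x
  have hx : ENNReal.ofReal (|g x| ^ q x / q x) = 0 := hx
  rw [ENNReal.ofReal_eq_zero] at hx
  by_contra hne
  have : 0 < |g x| := abs_pos.2 hne
  have : 0 < |g x| ^ q x / q x := by positivity
  linarith

end Variation

/-! ### `K` and `k` as Luxemburg norms on `X`. -/

section Bridge

variable {N : ℕ} {s : ℝ} {p : EuclideanSpace ℝ (Fin N) → EuclideanSpace ℝ (Fin N) → ℝ}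
  {Ω : Set (EuclideanSpace ℝ (Fin N))} {a b : ℝ} {u v φ : EuclideanSpace ℝ (Fin N) → ℝ}

/-- The measure `dx dy / |x - y|^N`. -/
noncomputable def fracMeasure (N : ℕ) :
    Measure (EuclideanSpace ℝ (Fin N) × EuclideanSpace ℝ (Fin N)) :=
  volume.withDensity fun z => ENNReal.ofReal ((‖z.1 - z.2‖ ^ (N : ℝ))⁻¹)

theorem measurable_fracDensity : Measurable
    fun z : EuclideanSpace ℝ (Fin N) × EuclideanSpace ℝ (Fin N) =>
      ENNReal.ofReal ((‖z.1 - z.2‖ ^ (N : ℝ))⁻¹) := by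
  fun_prop

theorem integral_fracMeasure
    (f : EuclideanSpace ℝ (Fin N) × EuclideanSpace ℝ (Fin N) → ℝ) :
    ∫ z, f z ∂fracMeasure N = ∫ z, f z / ‖z.1 - z.2‖ ^ (N : ℝ) := by
  rw [fracMeasure, integral_withDensity_eq_integral_toReal_smul measurable_fracDensity
    (Filter.Eventually.of_forall fun _ => ENNReal.ofReal_lt_top)]
  refine integral_congr_ae (Filter.Eventually.of_forall fun z => ?_)
  simp only [smul_eq_mul]
  rw [ENNReal.toReal_ofReal (by positivity), div_eq_inv_mul]

theorem abs_sub_rpow_div {P : ℝ} (hP : 0 < P)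
    (z : EuclideanSpace ℝ (Fin N) × EuclideanSpace ℝ (Fin N)) :
    |u z.1 - u z.2| ^ P / ‖z.1 - z.2‖ ^ ((N : ℝ) + s * P) =
      (‖z.1 - z.2‖ ^ (N : ℝ))⁻¹ * |grad s u z| ^ P := by
  unfold grad
  rcases eq_or_ne z.1 z.2 with h | h
  -- On the diagonal both sides are 0: the numerators are powers of 0 with positive exponent.
  · simp [h, Real.zero_rpow hP.ne']
  · have hd : 0 < ‖z.1 - z.2‖ := norm_pos_iff.2 (sub_ne_zero.2 h)
    rw [abs_div, Real.div_rpow (abs_nonneg _) (abs_nonneg _),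
      abs_of_pos (Real.rpow_pos_of_pos hd s),
      ← Real.rpow_mul hd.le, Real.rpow_add hd]
    field_simp

theorem lintegral_fracMeasure
    (f : EuclideanSpace ℝ (Fin N) × EuclideanSpace ℝ (Fin N) → ℝ) :
    ∫⁻ z, ENNReal.ofReal (f z) ∂fracMeasure N =
      ∫⁻ z, ENNReal.ofReal ((‖z.1 - z.2‖ ^ (N : ℝ))⁻¹ * f z) := by
  rw [fracMeasure, lintegral_withDensity_eq_lintegral_mul_non_measurable _ measurable_fracDensity
    (Filter.Eventually.of_forall fun _ => ENNReal.ofReal_lt_top)]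
  refine lintegral_congr fun z => ?_
  rw [Pi.mul_apply, ← ENNReal.ofReal_mul (by positivity)]

theorem rho_eq_modular (hP : ∀ x y, 0 < p x y) (u : EuclideanSpace ℝ (Fin N) → ℝ) :
    rho s p u = modular (fracMeasure N) (fun z => p z.1 z.2) (grad s u) := by
  unfold rho modular
  rw [lintegral_fracMeasure]
  refine lintegral_congr fun z => ?_
  rw [abs_sub_rpow_div (hP _ _), mul_div_assoc]

theorem energy_eq_lintegral (hP : ∀ x y, 0 < p x y) (u : EuclideanSpace ℝ (Fin N) → ℝ) :
    energy s p u = ∫⁻ z, ENNReal.ofReal (|grad s u z| ^ p z.1 z.2) ∂fracMeasure N := by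
  unfold energy
  rw [lintegral_fracMeasure]
  refine lintegral_congr fun z => ?_
  rw [abs_sub_rpow_div (hP _ _)]

theorem aemeasurable_comp_fst (hu : AEMeasurable u volume) : AEMeasurable
    (fun z : EuclideanSpace ℝ (Fin N) × EuclideanSpace ℝ (Fin N) => u z.1) volume :=
  hu.comp_quasiMeasurePreserving Measure.quasiMeasurePreserving_fst

theorem aemeasurable_comp_snd (hu : AEMeasurable u volume) : AEMeasurable
    (fun z : EuclideanSpace ℝ (Fin N) × EuclideanSpace ℝ (Fin N) => u z.2) volume :=
  hu.comp_quasiMeasurePreserving Measure.quasiMeasurePreserving_snd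

theorem aemeasurable_grad (hu : AEMeasurable u volume) :
    AEMeasurable (grad s u) (fracMeasure N) := by
  refine AEMeasurable.mono_ac (ν := volume) ?_ (withDensity_absolutelyContinuous _ _)
  have h : Measurable fun z : EuclideanSpace ℝ (Fin N) × EuclideanSpace ℝ (Fin N) =>
    ‖z.1 - z.2‖ ^ s := by fun_prop
  exact ((aemeasurable_comp_fst hu).sub (aemeasurable_comp_snd hu)).div h.aemeasurable

theorem grad_div (l : ℝ) :
    grad s (fun x => u x / l) = fun z => grad s u z / l := by
  ext z
  simp only [grad]
  ring

theorem grad_add_mul (t : ℝ) :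
    grad s (fun x => u x + t * v x) = fun z => grad s u z + t * grad s v z := by
  ext z
  simp only [grad]
  ring

theorem ExponentBounds.diag (hP : ExponentBounds (fun z : EuclideanSpace ℝ (Fin N) ×
    EuclideanSpace ℝ (Fin N) => p z.1 z.2) a b) : ExponentBounds (fun x => p x x) a b where
  measurable := hP.measurable.comp (measurable_id.prodMk measurable_id)
  one_lt := hP.one_lt
  le x := hP.le (x, x)
  ge x := hP.ge (x, x)

theorem IsAdmissibleExponent.exponentBounds (hp : IsAdmissibleExponent s p) :
    ∃ a b, ExponentBounds (fun z : EuclideanSpace ℝ (Fin N) × EuclideanSpace ℝ (Fin N) =>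
      p z.1 z.2) a b := by
  obtain ⟨a, ha, ha'⟩ := hp.one_lt_inf
  obtain ⟨b, -, hb'⟩ := hp.sup_lt
  exact ⟨a, b, hp.continuous.measurable, ha, fun z => ha' _ _, fun z => hb' _ _⟩

theorem mem_X_iff (hP : ExponentBounds (fun z : EuclideanSpace ℝ (Fin N) ×
    EuclideanSpace ℝ (Fin N) => p z.1 z.2) a b) :
    u ∈ X s p Ω ↔ AEMeasurable u volume ∧ modular volume (fun x => p x x) u ≠ ∞ ∧
      modular (fracMeasure N) (fun z => p z.1 z.2) (grad s u) ≠ ∞ ∧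
      ∀ᵐ x ∂(volume : Measure (EuclideanSpace ℝ (Fin N))), x ∉ Ω → u x = 0 := by
  simp only [X, Set.mem_ofPred_eq, lt_top_iff_ne_top]
  rw [energy_eq_lintegral (fun x y => hP.pos (x, y)), lintegral_rpow_ne_top_iff hP,
    lintegral_rpow_ne_top_iff hP.diag]

theorem modular_restrict_ne_top (hP : ExponentBounds (fun z : EuclideanSpace ℝ (Fin N) ×
    EuclideanSpace ℝ (Fin N) => p z.1 z.2) a b) (hu : u ∈ X s p Ω) :
    modular (volume.restrict Ω) (fun x => p x x) u ≠ ∞ :=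
  ne_top_of_le_ne_top ((mem_X_iff hP).1 hu).2.1 (lintegral_mono' Measure.restrict_le_self le_rfl)

theorem add_mul_mem_X (hP : ExponentBounds (fun z : EuclideanSpace ℝ (Fin N) ×
    EuclideanSpace ℝ (Fin N) => p z.1 z.2) a b) (hu : u ∈ X s p Ω) (hv : v ∈ X s p Ω) (t : ℝ) :
    (fun x => u x + t * v x) ∈ X s p Ω := by
  rw [mem_X_iff hP] at hu hv ⊢
  obtain ⟨hu1, hu2, hu3, hu4⟩ := hu
  obtain ⟨hv1, hv2, hv3, hv4⟩ := hv
  refine ⟨hu1.add (hv1.const_mul t), modular_add_ne_top hP.diag hu1 hu2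
    (modular_const_mul_ne_top hP.diag t hv2), ?_, ?_⟩
  · rw [grad_add_mul]
    exact modular_add_ne_top hP (aemeasurable_grad hu1) hu3 (modular_const_mul_ne_top hP t hv3)
  · filter_upwards [hu4, hv4] with x h1 h2 hx
    rw [h1 hx, h2 hx]
    simp

theorem div_mem_X (hP : ExponentBounds (fun z : EuclideanSpace ℝ (Fin N) ×
    EuclideanSpace ℝ (Fin N) => p z.1 z.2) a b) (hu : u ∈ X s p Ω) {l : ℝ} (hl : 0 < l) :
    (fun x => u x / l) ∈ X s p Ω := by
  rw [mem_X_iff hP] at hu ⊢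
  obtain ⟨hu1, hu2, hu3, hu4⟩ := hu
  refine ⟨hu1.div_const l, modular_div_ne_top hP.diag hl hu2, ?_, ?_⟩
  · rw [grad_div]
    exact modular_div_ne_top hP hl hu3
  · filter_upwards [hu4] with x h1 hx
    rw [h1 hx, zero_div]

theorem not_nontriv_of_ae_restrict (hu : u ∈ X s p Ω) (hΩ : MeasurableSet Ω)
    (h : u =ᵐ[volume.restrict Ω] 0) : ¬ Nontriv u := by
  rw [Nontriv, not_not]
  rw [Filter.EventuallyEq, ae_restrict_iff' hΩ] at h
  filter_upwards [h, hu.2.2.2] with x h1 h2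
  by_cases hx : x ∈ Ω
  · exact h1 hx
  · exact h2 hx

theorem modular_restrict_ne_zero (hP : ExponentBounds (fun z : EuclideanSpace ℝ (Fin N) ×
    EuclideanSpace ℝ (Fin N) => p z.1 z.2) a b) (hΩ : MeasurableSet Ω) (hu : u ∈ X s p Ω)
    (hn : Nontriv u) : modular (volume.restrict Ω) (fun x => p x x) u ≠ 0 := fun h =>
  not_nontriv_of_ae_restrict hu hΩ
    (ae_eq_zero_of_modular_eq_zero hP.diag hu.1.restrict h) hn

theorem k_spec (hP : ExponentBounds (fun z : EuclideanSpace ℝ (Fin N) ×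
    EuclideanSpace ℝ (Fin N) => p z.1 z.2) a b) (hΩ : MeasurableSet Ω) (hu : u ∈ X s p Ω)
    (hn : Nontriv u) : 0 < k p Ω u ∧
      modular (volume.restrict Ω) (fun x => p x x) (fun x => u x / k p Ω u) = 1 :=
  modular_div_sInf hP.diag (fun _ hl => hl) (fun _ h1 h2 => ⟨h1, h2.le⟩)
    (modular_restrict_ne_zero hP hΩ hu hn) (modular_restrict_ne_top hP hu)

theorem ae_eq_of_rho_eq_zero (hP : ExponentBounds (fun z : EuclideanSpace ℝ (Fin N) ×
    EuclideanSpace ℝ (Fin N) => p z.1 z.2) a b) (hu : AEMeasurable u volume)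
    (h : rho s p u = 0) :
    ∀ᵐ z : EuclideanSpace ℝ (Fin N) × EuclideanSpace ℝ (Fin N), u z.1 = u z.2 := by
  unfold rho at h
  have hm : Measurable fun z : EuclideanSpace ℝ (Fin N) × EuclideanSpace ℝ (Fin N) => p z.1 z.2 :=
    hP.measurable
  have hn : Measurable fun z : EuclideanSpace ℝ (Fin N) × EuclideanSpace ℝ (Fin N) =>
    ‖z.1 - z.2‖ ^ ((N : ℝ) + s * p z.1 z.2) := by fun_prop
  rw [lintegral_eq_zero_iff'] at h
  · filter_upwards [h] with z hz
    by_contra hne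
    have hne' : z.1 ≠ z.2 := fun h => hne (by rw [h])
    have h1 : 0 < |u z.1 - u z.2| := abs_pos.2 (sub_ne_zero.2 hne)
    have h2 : 0 < ‖z.1 - z.2‖ := norm_pos_iff.2 (sub_ne_zero.2 hne')
    have h3 : 0 < p z.1 z.2 := hP.pos z
    have h4 := ENNReal.ofReal_eq_zero.1 hz
    have : 0 < |u z.1 - u z.2| ^ p z.1 z.2 / ‖z.1 - z.2‖ ^ ((N : ℝ) + s * p z.1 z.2) / p z.1 z.2 := by
      positivity
    linarith
  · exact (((measurable_norm.comp_aemeasurable ((aemeasurable_comp_fst hu).sub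
      (aemeasurable_comp_snd hu))).pow hm.aemeasurable).div hn.aemeasurable).div
      hm.aemeasurable |>.ennreal_ofReal

/-- With zero energy, `u x = u y` for almost every pair. The complement of the bounded set `Ω` has
positive measure and `u` vanishes there, so the common value is 0. -/
theorem rho_ne_zero (hN : 0 < N) (hP : ExponentBounds (fun z : EuclideanSpace ℝ (Fin N) ×
    EuclideanSpace ℝ (Fin N) => p z.1 z.2) a b) (hb : Bornology.IsBounded Ω) (hu : u ∈ X s p Ω)
    (hn : Nontriv u) : rho s p u ≠ 0 := by
  intro h
  have h1 := ae_eq_of_rho_eq_zero hP hu.1 h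
  rw [Measure.volume_eq_prod] at h1
  have h2 := Measure.ae_ae_of_ae_prod h1
  have hinf : (volume : Measure (EuclideanSpace ℝ (Fin N))) Ωᶜ ≠ 0 := by
    intro h0
    have : Nontrivial (EuclideanSpace ℝ (Fin N)) := by
      have : Nonempty (Fin N) := ⟨⟨0, hN⟩⟩
      infer_instance
    have h3 : (volume : Measure (EuclideanSpace ℝ (Fin N))) Set.univ = ∞ :=
      measure_univ_of_isAddLeftInvariant _
    have h4 := measure_union_le (μ := (volume : Measure (EuclideanSpace ℝ (Fin N)))) Ω Ωᶜ
    rw [Set.union_compl_self, h3, h0, add_zero] at h4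
    exact absurd h4 (not_le.2 hb.measure_lt_top)
  apply hn
  filter_upwards [h2] with x hx
  by_contra hne
  apply hinf
  rw [← nonpos_iff_eq_zero]
  have h5 : (volume : Measure (EuclideanSpace ℝ (Fin N)))
      {y | ¬ (u x = u y ∧ (y ∉ Ω → u y = 0))} = 0 := hx.and hu.2.2.2
  rw [← h5]
  refine measure_mono fun y hy hcon => hne ?_
  rw [hcon.1, hcon.2 hy]
  rfl

theorem K_spec (hN : 0 < N) (hP : ExponentBounds (fun z : EuclideanSpace ℝ (Fin N) ×
    EuclideanSpace ℝ (Fin N) => p z.1 z.2) a b) (hb : Bornology.IsBounded Ω) (hu : u ∈ X s p Ω)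
    (hn : Nontriv u) : 0 < K s p u ∧
      modular (fracMeasure N) (fun z => p z.1 z.2) (fun z => grad s u z / K s p u) = 1 := by
  have hP0 : ∀ x y, 0 < p x y := fun x y => hP.pos (x, y)
  have h0 := rho_ne_zero hN hP hb hu hn
  rw [rho_eq_modular hP0] at h0
  refine modular_div_sInf hP (fun l hl => ⟨hl.1, ?_⟩) (fun l h1 h2 => ⟨h1, ?_⟩) h0
    ((mem_X_iff hP).1 hu).2.2.1
  · have := hl.2.le
    rwa [rho_eq_modular hP0, grad_div] at this
  · rwa [rho_eq_modular hP0, grad_div]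

/-! ### The weak equation for minimizers, and the value of an eigenvalue. -/

theorem bddBelow_H_image : BddBelow (H s p Ω '' {v | v ∈ X s p Ω ∧ Nontriv v}) := by
  refine ⟨0, ?_⟩
  rintro _ ⟨v, -, rfl⟩
  exact div_nonneg (Real.sInf_nonneg fun l hl => hl.1.le) (Real.sInf_nonneg fun l hl => hl.1.le)

theorem Lambda1_le (hu : u ∈ X s p Ω) (hn : Nontriv u) : Lambda1 s p Ω ≤ H s p Ω u :=
  csInf_le bddBelow_H_image ⟨u, ⟨hu, hn⟩, rfl⟩

/-- This is `Λ₁ k(v) ≤ K(v)` at the level of modulars. If the modular of `∇ₛv` were below 1, then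
`K(v) < 1`, hence `k(v) < 1 / Λ₁`, and `Λ₁ v` would have modular at most 1. -/
theorem one_le_modular_grad (hN : 0 < N) (hP : ExponentBounds (fun z : EuclideanSpace ℝ (Fin N) ×
    EuclideanSpace ℝ (Fin N) => p z.1 z.2) a b) (hb : Bornology.IsBounded Ω)
    (hΩ : MeasurableSet Ω) (hv : v ∈ X s p Ω) (hL : 0 < Lambda1 s p Ω)
    (h1 : 1 < modular (volume.restrict Ω) (fun x => p x x) (fun x => Lambda1 s p Ω * v x)) :
    1 ≤ modular (fracMeasure N) (fun z => p z.1 z.2) (grad s v) := by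
  by_contra! hcon
  have hP0 : ∀ x y, 0 < p x y := fun x y => hP.pos (x, y)
  have hn : Nontriv v := by
    intro h0
    have h2 : modular (volume.restrict Ω) (fun x => p x x) (fun x => Lambda1 s p Ω * v x) = 0 := by
      unfold modular
      refine lintegral_eq_zero_of_ae_eq_zero ?_
      filter_upwards [ae_restrict_of_ae h0] with x hx
      simp [hx, Real.zero_rpow (hP0 x x).ne']
    rw [h2] at h1
    exact absurd h1 (by simp)
  obtain ⟨hK0, hK1⟩ := K_spec hN hP hb hv hn
  obtain ⟨hk0, hk1⟩ := k_spec hP hΩ hv hn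
  have hK : K s p v < 1 := by
    -- The number 1 is admissible in the infimum defining `K`, and `K = 1` would force the modular
    -- of `∇ₛv` to be 1.
    refine lt_of_le_of_ne (csInf_le ⟨0, fun l hl => hl.1.le⟩ ⟨one_pos, ?_⟩) fun h => ?_
    · simpa [rho_eq_modular hP0] using hcon
    · simp only [h, div_one] at hK1
      exact hcon.ne hK1
  have h2 := Lambda1_le hv hn
  rw [H, le_div_iff₀ hk0] at h2
  have h3 : k p Ω v ≤ (Lambda1 s p Ω)⁻¹ := by
    rw [← one_div, le_div_iff₀ hL]
    linarith
  have h4 := modular_div_anti (μ := volume.restrict Ω) (g := v) hP.diag hk0 h3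
  rw [hk1] at h4
  refine absurd h1 (not_lt.2 (le_of_eq_of_le ?_ h4))
  congr 1
  ext x
  rw [div_inv_eq_mul, mul_comm]

/-- If `A / A₀ < B / B₀`, then taking `c` to be minus the midpoint of the two ratios makes `B + c
B₀` positive and `A + c A₀` negative. -/
theorem mul_le_mul_of_forall_pos {A B A₀ B₀ : ℝ} (hA : 0 < A₀) (hB : 0 < B₀)
    (h : ∀ c, 0 < B + c * B₀ → 0 ≤ A + c * A₀) : A₀ * B ≤ A * B₀ := by
  by_contra! hcon
  have h1 : A / A₀ < B / B₀ := by
    rw [div_lt_div_iff₀ hA hB]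
    linarith
  have h2 := h (-((A / A₀ + B / B₀) / 2)) (by
    have : B = B / B₀ * B₀ := by field_simp
    nlinarith)
  have : A = A / A₀ * A₀ := by field_simp
  nlinarith

theorem S_eq : S s p Ω u =
    (∫ z, |grad s u z / K s p u| ^ p z.1 z.2 ∂fracMeasure N) /
      ∫ x in Ω, |u x / k p Ω u| ^ p x x := by
  rw [integral_fracMeasure, S]

/-- A Lagrange multiplier argument with linear forms `A` and `B`, the derivatives at `w` of the
modulars of `∇ₛw` and `Λ₁ w`. Minimality gives that `B ψ > 0` implies `A ψ ≥ 0`. Applying this to `ψ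
+ c w` for every `c` turns it into a linear inequality, and replacing `φ` by `-φ` turns that into an
equality. -/
theorem IsMinimizer.isEigenpair (hN : 0 < N) (hP : ExponentBounds (fun z :
    EuclideanSpace ℝ (Fin N) × EuclideanSpace ℝ (Fin N) => p z.1 z.2) a b)
    (hb : Bornology.IsBounded Ω) (hΩ : MeasurableSet Ω) (h : IsMinimizer s p Ω u) :
    IsEigenpair s p Ω (Lambda1 s p Ω) u := by
  obtain ⟨hu, hn, hH⟩ := h
  refine ⟨hu, hn, fun φ hφ => ?_⟩
  obtain ⟨hK0, hK1⟩ := K_spec hN hP hb hu hn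
  obtain ⟨hk0, hk1⟩ := k_spec hP hΩ hu hn
  have hL : 0 < Lambda1 s p Ω := by rw [← hH]; exact div_pos hK0 hk0
  set L := Lambda1 s p Ω with hLdef
  set κ := K s p u with hκ
  set m := k p Ω u with hm
  have hLe : L = κ / m := by rw [← hH, H]
  set w : EuclideanSpace ℝ (Fin N) → ℝ := fun x => u x / κ with hw
  have hwX : w ∈ X s p Ω := div_mem_X hP hu hK0
  have hgw : grad s w = fun z => grad s u z / κ := grad_div κ
  have hLw : ∀ x, u x / m = L * w x := fun x => by
    rw [hLe, hw]
    field_simp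
  set A : (EuclideanSpace ℝ (Fin N) → ℝ) → ℝ := fun ψ =>
    ∫ z, |grad s u z / κ| ^ (p z.1 z.2 - 2) * (grad s u z / κ) * grad s ψ z ∂fracMeasure N with hA
  set B : (EuclideanSpace ℝ (Fin N) → ℝ) → ℝ := fun ψ =>
    ∫ x in Ω, |u x / m| ^ (p x x - 2) * (u x / m) * (L * ψ x) with hB
  have hgm : AEMeasurable (fun z => grad s u z / κ) (fracMeasure N) :=
    (aemeasurable_grad hu.1).div_const κ
  have hum : AEMeasurable (fun x => u x / m) (volume.restrict Ω) := (hu.1.div_const m).restrict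
  have hAi : ∀ ψ ∈ X s p Ω, Integrable (fun z => |grad s u z / κ| ^ (p z.1 z.2 - 2) *
      (grad s u z / κ) * grad s ψ z) (fracMeasure N) := fun ψ hψ =>
    integrable_deriv hP hgm (aemeasurable_grad hψ.1) (by rw [hK1]; simp)
      ((mem_X_iff hP).1 hψ).2.2.1
  have hLψ : ∀ ψ ∈ X s p Ω,
      modular (volume.restrict Ω) (fun x => p x x) (fun x => L * ψ x) ≠ ∞ := fun ψ hψ =>
    modular_const_mul_ne_top hP.diag L (modular_restrict_ne_top hP hψ)
  have hBi : ∀ ψ ∈ X s p Ω, Integrable (fun x => |u x / m| ^ (p x x - 2) *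
      (u x / m) * (L * ψ x)) (volume.restrict Ω) := fun ψ hψ =>
    integrable_deriv hP.diag hum (hψ.1.const_mul L).restrict (by rw [hk1]; simp) (hLψ ψ hψ)
  have hAadd : ∀ ψ ∈ X s p Ω, ∀ c : ℝ, A (fun x => ψ x + c * w x) = A ψ + c * A w := by
    intro ψ hψ c
    simp only [hA]
    rw [← integral_const_mul, ← integral_add (hAi ψ hψ) ((hAi w hwX).const_mul c)]
    refine integral_congr_ae (Filter.Eventually.of_forall fun z => ?_)
    simp only [grad_add_mul]
    ring
  have hBadd : ∀ ψ ∈ X s p Ω, ∀ c : ℝ, B (fun x => ψ x + c * w x) = B ψ + c * B w := by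
    intro ψ hψ c
    simp only [hB]
    rw [← integral_const_mul, ← integral_add (hBi ψ hψ) ((hBi w hwX).const_mul c)]
    refine integral_congr_ae (Filter.Eventually.of_forall fun z => ?_)
    ring
  have hAw : A w = ∫ z, |grad s u z / κ| ^ p z.1 z.2 ∂fracMeasure N := by
    refine integral_congr_ae (Filter.Eventually.of_forall fun z => ?_)
    simp only [hgw]
    exact abs_rpow_sub_two_mul_sq (hP.pos z)
  have hBw : B w = ∫ x in Ω, |u x / m| ^ p x x := by
    refine integral_congr_ae (Filter.Eventually.of_forall fun x => ?_)
    simp only [← hLw]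
    exact abs_rpow_sub_two_mul_sq (hP.diag.pos x)
  have hAw0 : 0 < A w := by
    rw [hAw]
    exact integral_abs_rpow_pos hP hgm (by rw [hK1]; simp) (by rw [hK1]; simp)
  have hBw0 : 0 < B w := by
    rw [hBw]
    exact integral_abs_rpow_pos hP.diag hum (by rw [hk1]; simp) (by rw [hk1]; simp)
  have key : ∀ ψ ∈ X s p Ω, 0 < B ψ → 0 ≤ A ψ := by
    intro ψ hψ hBψ
    by_contra! hneg
    have e1 := eventually_one_lt_modular hP.diag hum (hψ.1.const_mul L).restrict hk1 (hLψ ψ hψ) hBψ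
    have e2 := eventually_modular_lt_one hP hgm (aemeasurable_grad hψ.1) hK1
      ((mem_X_iff hP).1 hψ).2.2.1 hneg
    obtain ⟨t, ht1, ht2⟩ := (e1.and e2).exists
    -- For this `t`, the perturbation `w + t ψ` has modular above 1 on `Ω` after multiplication by
    -- `L`, yet gradient modular below 1, against `one_le_modular_grad`.
    refine absurd ht2 (not_lt.2 ?_)
    have h3 := one_le_modular_grad hN hP hb hΩ (add_mul_mem_X hP hwX hψ t) hL (by
      refine ht1.trans_eq (congrArg _ (funext fun x => ?_))
      rw [hLw]
      ring)
    rwa [grad_add_mul, hgw] at h3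
  have key2 : ∀ ψ ∈ X s p Ω, A w * B ψ ≤ A ψ * B w := fun ψ hψ =>
    mul_le_mul_of_forall_pos hAw0 hBw0 fun c hc => by
      rw [← hBadd ψ hψ] at hc
      rw [← hAadd ψ hψ]
      exact key _ (add_mul_mem_X hP hψ hwX c) hc
  have key3 : A φ * B w = A w * B φ := by
    refine le_antisymm ?_ (key2 φ hφ)
    -- The test function is `-φ`, written as `φ - 2 φ + 0 w` so that `add_mul_mem_X` gives its
    -- membership in `X`.
    have h4 := key2 _ (add_mul_mem_X hP (add_mul_mem_X hP hφ hφ (-2)) hwX 0)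
    have h5 : A (fun x => φ x + -2 * φ x + 0 * w x) = - A φ := by
      simp only [hA]
      rw [← integral_neg]
      refine integral_congr_ae (Filter.Eventually.of_forall fun z => ?_)
      simp only [grad]
      ring
    have h6 : B (fun x => φ x + -2 * φ x + 0 * w x) = - B φ := by
      simp only [hB]
      rw [← integral_neg]
      refine integral_congr_ae (Filter.Eventually.of_forall fun z => ?_)
      ring
    rw [h5, h6] at h4
    linarith
  have hBφ : B φ = L * ∫ x in Ω, |u x / m| ^ (p x x - 2) * (u x / m) * φ x := by
    simp only [hB]
    rw [← integral_const_mul]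
    refine integral_congr_ae (Filter.Eventually.of_forall fun z => ?_)
    ring
  rw [← integral_fracMeasure (fun z => |grad s u z / κ| ^ (p z.1 z.2 - 2) *
    (grad s u z / κ) * grad s φ z), S_eq, ← hκ, ← hm, ← hAw, ← hBw]
  change A φ = _
  rw [mul_right_comm, ← hBφ]
  field_simp
  linarith

/-- Test with `φ = u`. The two sides become `K(u)` and `Λ S(u) k(u)` times the integrals whose
quotient is `S(u)`, and these integrals are positive. -/
theorem IsEigenpair.eq_div (hN : 0 < N) (hP : ExponentBounds (fun z :
    EuclideanSpace ℝ (Fin N) × EuclideanSpace ℝ (Fin N) => p z.1 z.2) a b)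
    (hb : Bornology.IsBounded Ω) (hΩ : MeasurableSet Ω) {L : ℝ} (h : IsEigenpair s p Ω L u) :
    L = K s p u / k p Ω u := by
  obtain ⟨hu, hn, hw⟩ := h
  obtain ⟨hK0, hK1⟩ := K_spec hN hP hb hu hn
  obtain ⟨hk0, hk1⟩ := k_spec hP hΩ hu hn
  have h1 := hw u hu
  rw [← integral_fracMeasure (fun z => |grad s u z / K s p u| ^ (p z.1 z.2 - 2) *
    (grad s u z / K s p u) * grad s u z), S_eq] at h1
  have hA : ∫ z, |grad s u z / K s p u| ^ (p z.1 z.2 - 2) *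
      (grad s u z / K s p u) * grad s u z ∂fracMeasure N =
      K s p u * ∫ z, |grad s u z / K s p u| ^ p z.1 z.2 ∂fracMeasure N := by
    rw [← integral_const_mul]
    refine integral_congr_ae (Filter.Eventually.of_forall fun z => ?_)
    simp only [← abs_rpow_sub_two_mul_sq (hP.pos z)]
    field_simp
  have hB : ∫ x in Ω, |u x / k p Ω u| ^ (p x x - 2) * (u x / k p Ω u) * u x =
      k p Ω u * ∫ x in Ω, |u x / k p Ω u| ^ p x x := by
    rw [← integral_const_mul]
    refine integral_congr_ae (Filter.Eventually.of_forall fun x => ?_)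
    simp only [← abs_rpow_sub_two_mul_sq (hP.diag.pos x)]
    field_simp
  have hA0 := integral_abs_rpow_pos hP ((aemeasurable_grad hu.1).div_const (K s p u))
    (by rw [hK1]; simp) (by rw [hK1]; simp)
  have hB0 := integral_abs_rpow_pos hP.diag (hu.1.div_const (k p Ω u)).restrict
    (by rw [hk1]; simp) (by rw [hk1]; simp)
  rw [hA, hB] at h1
  field_simp at h1
  rw [eq_div_iff hk0.ne']
  linarith

end Bridge

/-! ### Higher integrability from the pointwise energy density. -/

section Gain

variable {N : ℕ} {s : ℝ} {p : EuclideanSpace ℝ (Fin N) → EuclideanSpace ℝ (Fin N) → ℝ}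
  {Ω : Set (EuclideanSpace ℝ (Fin N))} {a b : ℝ} {u : EuclideanSpace ℝ (Fin N) → ℝ}

/-- The density at `x` of the fractional energy of `u`. -/
noncomputable def energyAt (s : ℝ)
    (p : EuclideanSpace ℝ (Fin N) → EuclideanSpace ℝ (Fin N) → ℝ)
    (u : EuclideanSpace ℝ (Fin N) → ℝ) (x : EuclideanSpace ℝ (Fin N)) : ℝ≥0∞ :=
  ∫⁻ y, ENNReal.ofReal (|u x - u y| ^ p x y / ‖x - y‖ ^ ((N : ℝ) + s * p x y))

theorem aemeasurable_energy_integrand (hP : ExponentBounds (fun z : EuclideanSpace ℝ (Fin N) ×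
    EuclideanSpace ℝ (Fin N) => p z.1 z.2) a b) (hu : AEMeasurable u volume) :
    AEMeasurable (fun z : EuclideanSpace ℝ (Fin N) × EuclideanSpace ℝ (Fin N) =>
      ENNReal.ofReal (|u z.1 - u z.2| ^ p z.1 z.2 / ‖z.1 - z.2‖ ^ ((N : ℝ) + s * p z.1 z.2)))
      volume := by
  have hm : Measurable fun z : EuclideanSpace ℝ (Fin N) × EuclideanSpace ℝ (Fin N) => p z.1 z.2 :=
    hP.measurable
  have hn : Measurable fun z : EuclideanSpace ℝ (Fin N) × EuclideanSpace ℝ (Fin N) =>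
    ‖z.1 - z.2‖ ^ ((N : ℝ) + s * p z.1 z.2) := by fun_prop
  exact (((measurable_norm.comp_aemeasurable ((aemeasurable_comp_fst hu).sub
      (aemeasurable_comp_snd hu))).pow hm.aemeasurable).div hn.aemeasurable).ennreal_ofReal

theorem lintegral_energyAt (hP : ExponentBounds (fun z : EuclideanSpace ℝ (Fin N) ×
    EuclideanSpace ℝ (Fin N) => p z.1 z.2) a b) (hu : AEMeasurable u volume) :
    ∫⁻ x, energyAt s p u x = energy s p u := by
  have h := aemeasurable_energy_integrand (s := s) hP hu
  unfold energy energyAt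
  rw [Measure.volume_eq_prod] at h ⊢
  exact (lintegral_prod _ h).symm

/-- For `t ≥ c`, `t = t^(1-P) t^P` with `t^(1-P) ≤ c^(1-P) ≤ c^(1-m)`. The free level `c` stands in
for Young's inequality and needs only a lower bound `m` on the varying exponent. -/
theorem le_add_mul_rpow {t c m P : ℝ} (ht : 0 ≤ t) (hc : 1 ≤ c) (hm : m ≤ P) (hP : 1 ≤ P) :
    t ≤ c + c ^ (1 - m) * t ^ P := by
  have hc0 : 0 < c := by linarith
  rcases le_total t c with h | h
  · have : 0 ≤ c ^ (1 - m) * t ^ P := by positivity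
    linarith
  · have ht0 : 0 < t := by linarith
    have h1 : t = t ^ (1 - P) * t ^ P := by
      rw [← Real.rpow_add ht0, sub_add_cancel, Real.rpow_one]
    have h2 : t ^ (1 - P) ≤ c ^ (1 - P) := Real.rpow_le_rpow_of_nonpos hc0 h (by linarith)
    have h3 : c ^ (1 - P) ≤ c ^ (1 - m) := Real.rpow_le_rpow_of_exponent_le hc (by linarith)
    calc t = t ^ (1 - P) * t ^ P := h1
      _ ≤ c ^ (1 - m) * t ^ P := by gcongr; exact h2.trans h3
      _ ≤ _ := by linarith

theorem abs_sub_le_of_norm_le (hs : 0 < s) {x y : EuclideanSpace ℝ (Fin N)} {r c m : ℝ}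
    (hxy : ‖x - y‖ ≤ r) (hc : 1 ≤ c) (hm : m ≤ p x y) (hP : 1 ≤ p x y) :
    |u x - u y| ≤ r ^ s * c + r ^ s * c ^ (1 - m) * r ^ N *
      (|u x - u y| ^ p x y / ‖x - y‖ ^ ((N : ℝ) + s * p x y)) := by
  have hr : 0 ≤ r := (norm_nonneg _).trans hxy
  have hc0 : 0 < c := by linarith
  rcases eq_or_ne x y with h | h
  · rw [h, sub_self, abs_zero]
    positivity
  · have hd : 0 < ‖x - y‖ := norm_pos_iff.2 (sub_ne_zero.2 h)
    set d := ‖x - y‖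
    set t := |u x - u y| with ht
    have ht0 : 0 ≤ t := abs_nonneg _
    have h1 : (t / d ^ s) ^ p x y = d ^ N * (t ^ p x y / d ^ ((N : ℝ) + s * p x y)) := by
      rw [Real.div_rpow ht0 (by positivity), ← Real.rpow_mul hd.le, Real.rpow_add hd,
        Real.rpow_natCast]
      field_simp
    have h2 := le_add_mul_rpow (t := t / d ^ s) (by positivity) hc hm hP
    rw [h1] at h2
    have h3 : d ^ s ≤ r ^ s := Real.rpow_le_rpow hd.le hxy hs.le
    have h4 : d ^ N ≤ r ^ N := by gcongr
    calc t = d ^ s * (t / d ^ s) := by field_simp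
      _ ≤ r ^ s * (c + c ^ (1 - m) * (r ^ N * (t ^ p x y / d ^ ((N : ℝ) + s * p x y)))) := by
        gcongr
        exact h2.trans (by gcongr)
      _ = _ := by ring

theorem setLIntegral_enorm_sub_le (hs : 0 < s) {x : EuclideanSpace ℝ (Fin N)}
    {A : Set (EuclideanSpace ℝ (Fin N))} (hA : MeasurableSet A) {r c m : ℝ} (hr : 0 ≤ r)
    (hAr : A ⊆ Metric.closedBall x r) (hc : 1 ≤ c) (hm : ∀ y ∈ A, m ≤ p x y)
    (hP : ∀ y, 1 ≤ p x y) :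
    ∫⁻ y in A, ‖u x - u y‖ₑ ≤ ENNReal.ofReal (r ^ s * c) * volume A +
      ENNReal.ofReal (r ^ s * c ^ (1 - m) * r ^ N) * energyAt s p u x := by
  have hc0 : 0 < c := by linarith
  calc ∫⁻ y in A, ‖u x - u y‖ₑ
      ≤ ∫⁻ y in A, (ENNReal.ofReal (r ^ s * c) + ENNReal.ofReal (r ^ s * c ^ (1 - m) * r ^ N) *
        ENNReal.ofReal (|u x - u y| ^ p x y / ‖x - y‖ ^ ((N : ℝ) + s * p x y))) := by
        refine setLIntegral_mono' hA fun y hy => ?_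
        rw [← ENNReal.ofReal_mul (by positivity), ← ENNReal.ofReal_add (by positivity)
          (by positivity), Real.enorm_eq_ofReal_abs]
        refine ENNReal.ofReal_le_ofReal (abs_sub_le_of_norm_le hs ?_ hc (hm y hy) (hP y))
        rw [← dist_eq_norm, dist_comm]
        exact hAr hy
    _ = ENNReal.ofReal (r ^ s * c) * volume A + ENNReal.ofReal (r ^ s * c ^ (1 - m) * r ^ N) *
        ∫⁻ y in A, ENNReal.ofReal (|u x - u y| ^ p x y / ‖x - y‖ ^ ((N : ℝ) + s * p x y)) := by
        rw [lintegral_add_left measurable_const, setLIntegral_const,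
          lintegral_const_mul' _ _ ENNReal.ofReal_ne_top]
    _ ≤ _ := by
        gcongr
        exact setLIntegral_le_lintegral _ _

/-- The measure of the unit ball. -/
noncomputable def unitBallVolume (N : ℕ) : ℝ :=
  volume.real (Metric.ball (0 : EuclideanSpace ℝ (Fin N)) 1)

theorem unitBallVolume_pos (N : ℕ) : 0 < unitBallVolume N :=
  ENNReal.toReal_pos (Metric.measure_ball_pos _ _ one_pos).ne' measure_ball_lt_top.ne

theorem ofReal_unitBallVolume :
    ENNReal.ofReal (unitBallVolume N) = volume (Metric.ball (0 : EuclideanSpace ℝ (Fin N)) 1) :=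
  ENNReal.ofReal_toReal measure_ball_lt_top.ne

theorem volume_closedBall_eq (x : EuclideanSpace ℝ (Fin N)) {r : ℝ} (hr : 0 ≤ r) :
    volume (Metric.closedBall x r) = ENNReal.ofReal (unitBallVolume N * r ^ N) := by
  rw [Measure.addHaar_closedBall _ _ hr, finrank_euclideanSpace_fin, mul_comm,
    ENNReal.ofReal_mul (unitBallVolume_pos N).le, ofReal_unitBallVolume]

theorem volume_ball_eq (x : EuclideanSpace ℝ (Fin N)) {r : ℝ} (hr : 0 < r) :
    volume (Metric.ball x r) = ENNReal.ofReal (unitBallVolume N * r ^ N) := by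
  rw [Measure.addHaar_ball_of_pos _ _ hr, finrank_euclideanSpace_fin, mul_comm,
    ENNReal.ofReal_mul (unitBallVolume_pos N).le, ofReal_unitBallVolume]

/-- Integrate `|u x| ≤ |u y| + |u x - u y|` over `y` in the ball. The first term is controlled by
the `L¹` bound, the second by the energy density at `x`; `r` and `c` remain free. -/
theorem abs_mul_le_of_energyAt (hs : 0 < s) (hu : AEMeasurable u volume)
    {x : EuclideanSpace ℝ (Fin N)} {r c m M : ℝ} (hr : 0 < r) (hM : 0 ≤ M) (hc : 1 ≤ c)
    (hm : ∀ y ∈ Metric.closedBall x r, m ≤ p x y) (hP : ∀ y, 1 ≤ p x y)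
    (huM : ∫⁻ y, ‖u y‖ₑ ≤ ENNReal.ofReal M) (hD : energyAt s p u x ≠ ∞) :
    |u x| * (unitBallVolume N * r ^ N) ≤ M + r ^ s * c * (unitBallVolume N * r ^ N) +
      r ^ s * c ^ (1 - m) * r ^ N * (energyAt s p u x).toReal := by
  have hc0 : 0 < c := by linarith
  have hω := unitBallVolume_pos N
  have h1 : ‖u x‖ₑ * volume (Metric.closedBall x r) ≤
      ENNReal.ofReal M + ∫⁻ y in Metric.closedBall x r, ‖u x - u y‖ₑ := by
    rw [← setLIntegral_const]
    calc ∫⁻ y in Metric.closedBall x r, ‖u x‖ₑ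
        ≤ ∫⁻ y in Metric.closedBall x r, (‖u y‖ₑ + ‖u x - u y‖ₑ) := by
          refine lintegral_mono fun y => ?_
          calc ‖u x‖ₑ = ‖u y + (u x - u y)‖ₑ := by rw [add_sub_cancel]
            _ ≤ _ := enorm_add_le _ _
      _ = (∫⁻ y in Metric.closedBall x r, ‖u y‖ₑ) +
          ∫⁻ y in Metric.closedBall x r, ‖u x - u y‖ₑ :=
          lintegral_add_left' hu.enorm.restrict _
      _ ≤ _ := by
          gcongr
          exact (setLIntegral_le_lintegral _ _).trans huM
  have h2 := h1.trans (add_le_add_right (setLIntegral_enorm_sub_le hs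
    Metric.isClosed_closedBall.measurableSet hr.le subset_rfl hc hm hP) _)
  rw [volume_closedBall_eq x hr.le, Real.enorm_eq_ofReal_abs, ← ENNReal.ofReal_toReal hD,
    ← ENNReal.ofReal_mul (by positivity), ← ENNReal.ofReal_mul (by positivity),
    ← ENNReal.ofReal_mul (by positivity), ← ENNReal.ofReal_add (by positivity) (by positivity),
    ← ENNReal.ofReal_add (by positivity) (by positivity),
    ENNReal.ofReal_le_ofReal_iff (by positivity)] at h2
  linarith

/-- Optimization in `r` and `c`, giving `t ≤ C c^θ` with `c^m = 1 + d` and `θ = n / (n + s) < 1`.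
Since `θ < 1`, the power `Q` may exceed `m`; this is the whole source of the gain. -/
theorem rpow_le_of_forall_radius {t d ω M m r₀ n B Q : ℝ} {N : ℕ} (hn : n = N) (hs : 0 < s)
    (ht : 0 ≤ t) (hd : 0 ≤ d) (hω : 0 < ω) (hM : 0 ≤ M) (hm : 0 < m) (hr₀ : 0 < r₀) (hr₁ : r₀ ≤ 1)
    (h : ∀ r c, 0 < r → r ≤ r₀ → 1 ≤ c →
      t * (ω * r ^ N) ≤ M + r ^ s * c * (ω * r ^ N) + r ^ s * c ^ (1 - m) * r ^ N * d)
    (hQ : 0 ≤ Q) (hQB : Q ≤ B) (hQm : n / (n + s) * Q ≤ m) :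
    t ^ Q ≤ (M / (ω * r₀ ^ N) + 1 + 1 / ω) ^ B * (1 + d) := by
  have hn0 : 0 ≤ n := by rw [hn]; positivity
  have hns : 0 < n + s := by linarith
  -- This level makes `c^(1-m) d ≤ c`, so the energy term is no larger in order than the term `r^s
  -- c`.
  set c := (1 + d) ^ (1 / m) with hc
  have hcm : c ^ m = 1 + d := by
    rw [hc, ← Real.rpow_mul (by positivity), one_div_mul_cancel hm.ne', Real.rpow_one]
  have hc1 : 1 ≤ c := Real.one_le_rpow (by linarith) (by positivity)
  have hc0 : 0 < c := by linarith
  set θ := n / (n + s) with hθ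
  -- This radius balances the two remaining terms: `ρ^(-N)` and `ρ^s c` both equal `c^θ`.
  set ρ := c ^ (-(1 / (n + s))) with hρ
  have hρ0 : 0 < ρ := by positivity
  have hρ1 : ρ ≤ 1 := Real.rpow_le_one_of_one_le_of_nonpos hc1
    (by rw [neg_nonpos]; positivity)
  have hρN : ρ ^ N * c ^ θ = 1 := by
    rw [hρ, ← Real.rpow_natCast, ← Real.rpow_mul hc0.le, ← Real.rpow_add hc0, ← hn, hθ]
    convert Real.rpow_zero c using 2
    field_simp
    ring
  have hρs : ρ ^ s * c = c ^ θ := by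
    rw [hρ, ← Real.rpow_mul hc0.le, ← Real.rpow_add_one hc0.ne', hθ]
    congr 1
    field_simp
    ring
  set r := r₀ * ρ with hr
  have hr0 : 0 < r := by positivity
  have h1 := h r c hr0 (by rw [hr]; nlinarith) hc1
  have hrs : r ^ s * c ≤ c ^ θ := by
    rw [hr, Real.mul_rpow hr₀.le hρ0.le, mul_assoc, hρs]
    exact mul_le_of_le_one_left (by positivity) (Real.rpow_le_one hr₀.le hr₁ hs.le)
  have hcd : c ^ (1 - m) * d ≤ c := by
    calc c ^ (1 - m) * d ≤ c ^ (1 - m) * c ^ m := by gcongr; linarith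
      _ = c := by rw [← Real.rpow_add hc0, sub_add_cancel, Real.rpow_one]
  set C := M / (ω * r₀ ^ N) + 1 + 1 / ω with hC
  have hC1 : 1 ≤ C := by
    have : 0 ≤ M / (ω * r₀ ^ N) := by positivity
    have : 0 ≤ 1 / ω := by positivity
    linarith
  have hMr : M = M / (ω * r₀ ^ N) * c ^ θ * (ω * r ^ N) := by
    rw [hr, mul_pow]
    calc M = M / (ω * r₀ ^ N) * (ω * r₀ ^ N) * (ρ ^ N * c ^ θ) := by rw [hρN]; field_simp
      _ = _ := by ring
  have htC : t ≤ C * c ^ θ := by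
    have h2 : t * (ω * r ^ N) ≤ C * c ^ θ * (ω * r ^ N) := by
      calc t * (ω * r ^ N) ≤ M + r ^ s * c * (ω * r ^ N) + r ^ s * c ^ (1 - m) * r ^ N * d := h1
        _ = M + (r ^ s * c) * (ω * r ^ N) + r ^ s * (c ^ (1 - m) * d) * r ^ N := by ring
        _ ≤ M / (ω * r₀ ^ N) * c ^ θ * (ω * r ^ N) + c ^ θ * (ω * r ^ N) + c ^ θ * r ^ N := by
          rw [← hMr]
          gcongr
          exact (mul_le_mul_of_nonneg_left hcd (by positivity)).trans hrs
        _ = C * c ^ θ * (ω * r ^ N) := by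
          rw [hC]
          field_simp
    exact le_of_mul_le_mul_right h2 (by positivity)
  calc t ^ Q ≤ (C * c ^ θ) ^ Q := Real.rpow_le_rpow ht htC hQ
    _ = C ^ Q * c ^ (θ * Q) := by
      rw [Real.mul_rpow (by linarith) (by positivity), ← Real.rpow_mul hc0.le]
    _ ≤ C ^ B * c ^ m := by
      gcongr
    _ = C ^ B * (1 + d) := by rw [hcm]

/-- Uniform continuity of `p` on a compact product of balls; the extra 1 in the radius leaves room
for points within distance 1 of `Ω`. -/
theorem exists_radius_exponent (hp : Continuous fun z : EuclideanSpace ℝ (Fin N) ×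
    EuclideanSpace ℝ (Fin N) => p z.1 z.2) (hb : Bornology.IsBounded Ω) {δ : ℝ} (hδ : 0 < δ) :
    ∃ r₀, 0 < r₀ ∧ r₀ ≤ 1 ∧ ∀ x ∈ Ω, ∀ y ∈ Metric.closedBall x r₀, p x x - δ ≤ p x y := by
  obtain ⟨R, hR⟩ := hb.subset_closedBall 0
  have hK : IsCompact (Metric.closedBall (0 : EuclideanSpace ℝ (Fin N)) (R + 1) ×ˢ
      Metric.closedBall (0 : EuclideanSpace ℝ (Fin N)) (R + 1)) :=
    (isCompact_closedBall _ _).prod (isCompact_closedBall _ _)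
  have hU := hK.uniformContinuousOn_of_continuous hp.continuousOn
  obtain ⟨ε, hε, h⟩ := Metric.uniformContinuousOn_iff.1 hU δ hδ
  refine ⟨min 1 (ε / 2), by positivity, min_le_left _ _, fun x hx y hy => ?_⟩
  have hxR : dist x 0 ≤ R := hR hx
  have hy' : dist y x ≤ min 1 (ε / 2) := hy
  have hy1 : dist y x ≤ 1 := hy'.trans (min_le_left _ _)
  have hy2 : dist y x ≤ ε / 2 := hy'.trans (min_le_right _ _)
  have hyR : dist y 0 ≤ R + 1 := by linarith [dist_triangle y x 0]
  have h1 := h (x, x) ⟨by simp only [Metric.mem_closedBall]; linarith,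
    by simp only [Metric.mem_closedBall]; linarith⟩ (x, y)
    ⟨by simp only [Metric.mem_closedBall]; linarith, hyR⟩ (by
      rw [Prod.dist_eq, dist_self, dist_comm x y]
      exact max_lt hε (by linarith))
  rw [Real.dist_eq] at h1
  linarith [(abs_lt.1 h1).2]

/-- Higher integrability: functions that are bounded in `L¹` and have bounded energy are bounded in
the Lebesgue space of exponent `p(x, x) + η`, for some `η > 0`. -/
theorem exists_gain (hN : 0 < N) (hs0 : 0 < s) (hs1 : s < 1)
    (hP : ExponentBounds (fun z : EuclideanSpace ℝ (Fin N) ×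
      EuclideanSpace ℝ (Fin N) => p z.1 z.2) a b)
    (hp : Continuous fun z : EuclideanSpace ℝ (Fin N) × EuclideanSpace ℝ (Fin N) => p z.1 z.2)
    (hb : Bornology.IsBounded Ω) (hΩ : MeasurableSet Ω) {M : ℝ} (hM : 0 ≤ M) :
    ∃ η C : ℝ, 0 < η ∧ 0 < C ∧ ∀ u : EuclideanSpace ℝ (Fin N) → ℝ, AEMeasurable u volume →
      ∫⁻ y, ‖u y‖ₑ ≤ ENNReal.ofReal M →
      ∫⁻ x in Ω, ENNReal.ofReal (|u x| ^ (p x x + η)) ≤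
        ENNReal.ofReal C * (volume Ω + energy s p u) := by
  have hn : (1 : ℝ) ≤ N := by exact_mod_cast hN
  have hsn : s / N ≤ 1 := by rw [div_le_one (by linarith)]; linarith
  have hsn0 : 0 < s / N := by positivity
  have ha1 := hP.one_lt
  obtain ⟨r₀, hr₀, hr₁, hr⟩ := exists_radius_exponent (p := p) hp hb (δ := s / N / 4) (by positivity)
  have hω := unitBallVolume_pos N
  refine ⟨s / N / 2, (M / (unitBallVolume N * r₀ ^ N) + 1 + 1 / unitBallVolume N) ^ (b + 1),
    by positivity, by positivity, fun u hu huM => ?_⟩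
  set C := (M / (unitBallVolume N * r₀ ^ N) + 1 + 1 / unitBallVolume N) ^ (b + 1) with hC
  have hC0 : 0 < C := by positivity
  have key : ∀ x ∈ Ω, ENNReal.ofReal (|u x| ^ (p x x + s / N / 2)) ≤
      ENNReal.ofReal C * (1 + energyAt s p u x) := by
    intro x hx
    have hpa : a ≤ p x x := hP.le (x, x)
    have hpb : p x x ≤ b := hP.ge (x, x)
    by_cases hD : energyAt s p u x = ∞
    · rw [hD, add_top, ENNReal.mul_top (by simpa using hC0)]
      exact le_top
    · rw [← ENNReal.ofReal_toReal hD, ← ENNReal.ofReal_one, ← ENNReal.ofReal_add (by simp)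
        ENNReal.toReal_nonneg, ← ENNReal.ofReal_mul hC0.le]
      refine ENNReal.ofReal_le_ofReal (rpow_le_of_forall_radius (m := p x x - s / N / 4) rfl hs0
        (abs_nonneg _) ENNReal.toReal_nonneg hω hM (by linarith) hr₀ hr₁
        (fun r c hr0 hrr hc => abs_mul_le_of_energyAt hs0 hu hr0 hM hc
          (fun y hy => hr x hx y (Metric.closedBall_subset_closedBall hrr hy))
          (fun y => by linarith [hP.le (x, y)]) huM hD) (by linarith) (by linarith) ?_)
      -- With `σ = s / N ≤ 1` and `P = p x x`, the requirement is `P + σ/2 ≤ (1 + σ)(P - σ/4)`, that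
      -- is `3/4 + σ/4 ≤ P`.
      have h1 : (N : ℝ) / (N + s) = 1 / (1 + s / N) := by field_simp
      rw [h1, one_div_mul_eq_div, div_le_iff₀ (by linarith)]
      nlinarith
  calc ∫⁻ x in Ω, ENNReal.ofReal (|u x| ^ (p x x + s / N / 2))
      ≤ ∫⁻ x in Ω, ENNReal.ofReal C * (1 + energyAt s p u x) := setLIntegral_mono' hΩ key
    _ = ENNReal.ofReal C * (volume Ω + ∫⁻ x in Ω, energyAt s p u x) := by
      rw [lintegral_const_mul' _ _ ENNReal.ofReal_ne_top, lintegral_add_left measurable_const,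
        setLIntegral_one]
    _ ≤ _ := by
      gcongr
      rw [← lintegral_energyAt hP hu]
      exact setLIntegral_le_lintegral _ _

end Gain

/-! ### Compactness in `L¹(Ω)` through averages over balls. -/

section Compactness

variable {N : ℕ} {s : ℝ} {p : EuclideanSpace ℝ (Fin N) → EuclideanSpace ℝ (Fin N) → ℝ}
  {Ω : Set (EuclideanSpace ℝ (Fin N))} {a b : ℝ}

theorem enorm_sub_average_le {u : EuclideanSpace ℝ (Fin N) → ℝ}
    {A : Set (EuclideanSpace ℝ (Fin N))} (hA : volume A ≠ 0) (hA' : volume A ≠ ∞)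
    (hu : Integrable u) (x : EuclideanSpace ℝ (Fin N)) :
    ‖u x - ⨍ y in A, u y‖ₑ ≤ (volume A)⁻¹ * ∫⁻ y in A, ‖u x - u y‖ₑ := by
  set ν := (volume A)⁻¹ • volume.restrict A with hν
  have hprob : IsProbabilityMeasure ν := ⟨by
    rw [hν, Measure.smul_apply, Measure.restrict_apply_univ, smul_eq_mul,
      ENNReal.inv_mul_cancel hA hA']⟩
  have huν : Integrable u ν := hu.restrict.smul_measure (ENNReal.inv_ne_top.2 hA)
  have h1 : u x - ⨍ y in A, u y = ∫ y, (u x - u y) ∂ν := by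
    rw [integral_sub (integrable_const _) huν, integral_const, probReal_univ, one_smul,
      setAverage_eq']
  rw [h1]
  refine (enorm_integral_le_lintegral_enorm _).trans_eq ?_
  rw [hν, lintegral_smul_measure, smul_eq_mul]

/-- The averages form a sequence in a countable product of compact intervals, so one subsequence
serves all the sets at once. -/
theorem exists_subseq_tendsto_average {ι : Type*} [Countable ι]
    {u : ℕ → EuclideanSpace ℝ (Fin N) → ℝ} {M : ℝ} (hM : 0 ≤ M)
    (huM : ∀ n, ∫⁻ y, ‖u n y‖ₑ ≤ ENNReal.ofReal M) (A : ι → Set (EuclideanSpace ℝ (Fin N))) :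
    ∃ (φ : ℕ → ℕ) (L : ι → ℝ), StrictMono φ ∧
      (∀ i n, |⨍ y in A i, u n y| ≤ (volume.real (A i))⁻¹ * M) ∧
      ∀ i, Filter.Tendsto (fun n => ⨍ y in A i, u (φ n) y) Filter.atTop (nhds (L i)) := by
  have hbd : ∀ i n, |⨍ y in A i, u n y| ≤ (volume.real (A i))⁻¹ * M := by
    intro i n
    rw [setAverage_eq, smul_eq_mul, abs_mul, abs_of_nonneg (by positivity)]
    gcongr
    rw [← ENNReal.ofReal_le_ofReal_iff hM, ← Real.enorm_eq_ofReal_abs]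
    exact (enorm_integral_le_lintegral_enorm _).trans
      ((setLIntegral_le_lintegral _ _).trans (huM n))
  obtain ⟨L, -, φ, hφ, hL⟩ := (isCompact_univ_pi fun i : ι =>
    isCompact_Icc (a := -((volume.real (A i))⁻¹ * M)) (b := (volume.real (A i))⁻¹ * M)).tendsto_subseq
      (x := fun n i => ⨍ y in A i, u n y) (fun n i _ => abs_le.1 (hbd i n))
  exact ⟨φ, L, hφ, hbd, fun i => (tendsto_pi_nhds.1 hL) i⟩

/-- Taking the first ball of the countable cover that contains `x` keeps the choice measurable, so
the piecewise constant approximations by averages are measurable. -/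
theorem exists_measurable_index {r : ℝ} (hr : 0 < r) :
    ∃ j : EuclideanSpace ℝ (Fin N) → ℕ, Measurable j ∧
      ∀ x, x ∈ Metric.ball (TopologicalSpace.denseSeq (EuclideanSpace ℝ (Fin N)) (j x)) r := by
  classical
  have h : ∀ x : EuclideanSpace ℝ (Fin N),
      ∃ i, x ∈ Metric.ball (TopologicalSpace.denseSeq (EuclideanSpace ℝ (Fin N)) i) r := by
    intro x
    obtain ⟨i, hi⟩ := (TopologicalSpace.denseRange_denseSeq
      (EuclideanSpace ℝ (Fin N))).exists_dist_lt x hr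
    exact ⟨i, hi⟩
  exact ⟨fun x => Nat.find (h x), measurable_find h fun i => Metric.isOpen_ball.measurableSet,
    fun x => Nat.find_spec (h x)⟩

theorem enorm_sub_average_ball_le (hs : 0 < s) {u : EuclideanSpace ℝ (Fin N) → ℝ}
    (hu : Integrable u) (hP : ∀ x y, 1 ≤ p x y) {x c : EuclideanSpace ℝ (Fin N)} {r : ℝ}
    (hr : 0 < r) (hx : x ∈ Metric.ball c r) :
    ‖u x - ⨍ y in Metric.ball c r, u y‖ₑ ≤ ENNReal.ofReal ((2 * r) ^ s) *
      (1 + ENNReal.ofReal (2 ^ N / unitBallVolume N) * energyAt s p u x) := by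
  have hω := unitBallVolume_pos N
  have hV := volume_ball_eq c hr
  have hV0 : volume (Metric.ball c r) ≠ 0 := (Metric.measure_ball_pos _ _ hr).ne'
  have hVt : volume (Metric.ball c r) ≠ ∞ := measure_ball_lt_top.ne
  have hsub : Metric.ball c r ⊆ Metric.closedBall x (2 * r) := by
    intro y hy
    have h1 : dist y c < r := hy
    have h2 : dist x c < r := hx
    have h3 := dist_triangle_right y x c
    rw [Metric.mem_closedBall]
    linarith
  -- Here both the level `c` and the exponent bound `m` are 1: only the factor `(2 r)^s`, which
  -- vanishes with `r`, is needed.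
  have h1 := setLIntegral_enorm_sub_le (u := u) (m := 1) hs Metric.isOpen_ball.measurableSet
    (by positivity) hsub le_rfl (fun y _ => hP x y) (hP x)
  simp only [mul_one, sub_self, Real.rpow_zero] at h1
  refine (enorm_sub_average_le hV0 hVt hu x).trans ((mul_le_mul_right h1 _).trans_eq ?_)
  have h2 : (volume (Metric.ball c r))⁻¹ * ENNReal.ofReal ((2 * r) ^ s * (2 * r) ^ N) =
      ENNReal.ofReal ((2 * r) ^ s) * ENNReal.ofReal (2 ^ N / unitBallVolume N) := by
    rw [hV, ← ENNReal.ofReal_inv_of_pos (by positivity), ← ENNReal.ofReal_mul (by positivity),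
      ← ENNReal.ofReal_mul (by positivity), mul_pow]
    congr 1
    field_simp
  rw [mul_add, mul_add, mul_one, ← mul_assoc _ _ (energyAt s p u x), h2, mul_left_comm, ENNReal.inv_mul_cancel hV0 hVt,
    mul_one, mul_assoc]

/-- A sequence of functions with bounded energy that is bounded in `L¹` has a subsequence that
converges almost everywhere in a given bounded set. -/
theorem exists_subseq_tendsto_ae (hs : 0 < s) (hP : ExponentBounds (fun z :
      EuclideanSpace ℝ (Fin N) × EuclideanSpace ℝ (Fin N) => p z.1 z.2) a b)
    (hb : Bornology.IsBounded Ω) {M : ℝ} (hM : 0 ≤ M) {e : ℝ≥0∞}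
    (he : e ≠ ∞) {u : ℕ → EuclideanSpace ℝ (Fin N) → ℝ} (hu : ∀ n, AEMeasurable (u n) volume)
    (huM : ∀ n, ∫⁻ y, ‖u n y‖ₑ ≤ ENNReal.ofReal M) (hue : ∀ n, energy s p (u n) ≤ e) :
    ∃ (φ : ℕ → ℕ) (f : EuclideanSpace ℝ (Fin N) → ℝ), StrictMono φ ∧
      ∀ᵐ x ∂volume.restrict Ω, Filter.Tendsto (fun n => u (φ n) x) Filter.atTop (nhds (f x)) := by
  have hω := unitBallVolume_pos N
  have hui : ∀ n, Integrable (u n) := fun n =>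
    ⟨(hu n).aestronglyMeasurable, (huM n).trans_lt ENNReal.ofReal_lt_top⟩
  have hfin : IsFiniteMeasure (volume.restrict Ω) := ⟨by
    rw [Measure.restrict_apply_univ]
    exact hb.measure_lt_top⟩
  set r : ℕ → ℝ := fun m => 1 / ((m : ℝ) + 1) with hr
  have hr0 : ∀ m, 0 < r m := fun m => by positivity
  set A : ℕ × ℕ → Set (EuclideanSpace ℝ (Fin N)) := fun i =>
    Metric.ball (TopologicalSpace.denseSeq (EuclideanSpace ℝ (Fin N)) i.2) (r i.1) with hA
  obtain ⟨φ, L, hφ, hbd, hL⟩ := exists_subseq_tendsto_average hM huM A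
  choose j hjm hj using fun m => exists_measurable_index (N := N) (hr0 m)
  set C := volume Ω + ENNReal.ofReal (2 ^ N / unitBallVolume N) * e with hC
  have hCt : C ≠ ∞ := ENNReal.add_ne_top.2
    ⟨hb.measure_lt_top.ne, ENNReal.mul_ne_top ENNReal.ofReal_ne_top he⟩
  -- The error at scale `m` is uniform in `n`. With the convergence of the averages at fixed `m`,
  -- this makes the subsequence Cauchy in `L¹(Ω)`.
  have herr : ∀ m n, ∫⁻ x in Ω, ‖u n x - ⨍ y in A (m, j m x), u n y‖ₑ ≤
      ENNReal.ofReal ((2 * r m) ^ s) * C := by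
    intro m n
    calc ∫⁻ x in Ω, ‖u n x - ⨍ y in A (m, j m x), u n y‖ₑ
        ≤ ∫⁻ x in Ω, ENNReal.ofReal ((2 * r m) ^ s) *
          (1 + ENNReal.ofReal (2 ^ N / unitBallVolume N) * energyAt s p (u n) x) :=
          lintegral_mono fun x => enorm_sub_average_ball_le hs (hui n)
            (fun x y => by linarith [hP.one_lt, hP.le (x, y)]) (hr0 m) (hj m x)
      _ = ENNReal.ofReal ((2 * r m) ^ s) * (volume Ω +
          ENNReal.ofReal (2 ^ N / unitBallVolume N) * ∫⁻ x in Ω, energyAt s p (u n) x) := by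
          rw [lintegral_const_mul' _ _ ENNReal.ofReal_ne_top, lintegral_add_left measurable_const,
            setLIntegral_one, lintegral_const_mul' _ _ ENNReal.ofReal_ne_top]
      _ ≤ _ := by
          rw [hC]
          gcongr
          exact (setLIntegral_le_lintegral _ _).trans
            ((lintegral_energyAt hP (hu n)).trans_le (hue n))
  have hGm : ∀ m (l : ℕ × ℕ → ℝ), Measurable fun x => l (m, j m x) := fun m l =>
    (measurable_from_nat (f := fun i => l (m, i))).comp (hjm m)
  have hG : ∀ m, Filter.Tendsto (fun n =>
      ∫⁻ x in Ω, ‖(⨍ y in A (m, j m x), u (φ n) y) - L (m, j m x)‖ₑ) Filter.atTop (nhds 0) := by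
    intro m
    have h0 : ∫⁻ x in Ω, (0 : ℝ≥0∞) = 0 := by simp
    rw [← h0]
    have hV : ∀ i, (volume.real (A (m, i)))⁻¹ * M =
        (unitBallVolume N * r m ^ N)⁻¹ * M := fun i => by
      rw [measureReal_def, hA, volume_ball_eq _ (hr0 m), ENNReal.toReal_ofReal]
      have := hr0 m
      positivity
    set B := (unitBallVolume N * r m ^ N)⁻¹ * M with hB
    refine tendsto_lintegral_of_dominated_convergence (fun _ => ENNReal.ofReal (B + B))
      (fun n => ((hGm m fun i => ⨍ y in A i, u (φ n) y).sub (hGm m L)).enorm) (fun n => ?_) ?_ ?_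
    · refine Filter.Eventually.of_forall fun x => ?_
      have hb1 := hbd (m, j m x)
      rw [hV] at hb1
      have hb2 : |L (m, j m x)| ≤ B :=
        le_of_tendsto (hL (m, j m x)).abs (Filter.Eventually.of_forall fun n => hb1 (φ n))
      simp only [Real.enorm_eq_ofReal_abs]
      exact ENNReal.ofReal_le_ofReal ((abs_sub _ _).trans (add_le_add (hb1 _) hb2))
    · rw [setLIntegral_const]
      exact ENNReal.mul_ne_top ENNReal.ofReal_ne_top hb.measure_lt_top.ne
    · refine Filter.Eventually.of_forall fun x => ?_
      have h1 := ((hL (m, j m x)).sub_const (L (m, j m x))).enorm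
      simpa using h1
  have hF : ∀ m n, ∫⁻ x in Ω, ‖u (φ n) x - L (m, j m x)‖ₑ ≤
      ENNReal.ofReal ((2 * r m) ^ s) * C +
        ∫⁻ x in Ω, ‖(⨍ y in A (m, j m x), u (φ n) y) - L (m, j m x)‖ₑ := by
    intro m n
    refine le_trans ?_ (add_le_add_left (herr m (φ n)) _)
    have hmeas : Measurable fun x => ‖(⨍ y in A (m, j m x), u (φ n) y) - L (m, j m x)‖ₑ :=
      ((hGm m fun i => ⨍ y in A i, u (φ n) y).sub (hGm m L)).enorm
    rw [← lintegral_add_right _ hmeas]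
    refine lintegral_mono fun x => ?_
    calc ‖u (φ n) x - L (m, j m x)‖ₑ
        = ‖(u (φ n) x - ⨍ y in A (m, j m x), u (φ n) y) +
          ((⨍ y in A (m, j m x), u (φ n) y) - L (m, j m x))‖ₑ := by rw [sub_add_sub_cancel]
      _ ≤ _ := enorm_add_le _ _
  have hT : Filter.Tendsto (fun m => ENNReal.ofReal ((2 * r m) ^ s) * C) Filter.atTop
      (nhds 0) := by
    have h1 : Filter.Tendsto (fun m => (2 * r m) ^ s) Filter.atTop (nhds 0) := by
      have h2 : Filter.Tendsto (fun m => 2 * r m) Filter.atTop (nhds 0) := by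
        simpa [hr] using tendsto_one_div_add_atTop_nhds_zero_nat.const_mul (2 : ℝ)
      simpa [Real.zero_rpow hs.ne'] using h2.rpow_const (Or.inr hs.le)
    have h3 := ENNReal.Tendsto.mul_const (b := C) (ENNReal.tendsto_ofReal h1) (Or.inr hCt)
    simpa using h3
  have hLp : ∀ n, MemLp (u (φ n)) 1 (volume.restrict Ω) := fun n =>
    memLp_one_iff_integrable.2 (hui (φ n)).restrict
  have hcauchy : CauchySeq fun n => (hLp n).toLp (u (φ n)) := by
    rw [EMetric.cauchySeq_iff]
    intro ε hε
    have hε4 : 0 < ε / 2 / 2 := ENNReal.half_pos (ENNReal.half_pos hε.ne').ne'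
    obtain ⟨m, hm⟩ := (hT.eventually (gt_mem_nhds hε4)).exists
    obtain ⟨n₀, hn₀⟩ := Filter.eventually_atTop.1 ((hG m).eventually (gt_mem_nhds hε4))
    have hlt : ∀ n ≥ n₀, ∫⁻ x in Ω, ‖u (φ n) x - L (m, j m x)‖ₑ < ε / 2 := fun n hn =>
      (hF m n).trans_lt ((ENNReal.add_lt_add hm (hn₀ n hn)).trans_eq (ENNReal.add_halves _))
    refine ⟨n₀, fun n hn n' hn' => ?_⟩
    rw [Lp.edist_toLp_toLp, eLpNorm_one_eq_lintegral_enorm]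
    refine lt_of_le_of_lt ?_ ((ENNReal.add_lt_add (hlt n hn) (hlt n' hn')).trans_eq
      (ENNReal.add_halves _))
    have hmeas : AEMeasurable (fun x => ‖u (φ n') x - L (m, j m x)‖ₑ) (volume.restrict Ω) :=
      ((hu (φ n')).restrict.sub (hGm m L).aemeasurable).enorm
    rw [← lintegral_add_right' _ hmeas]
    refine lintegral_mono fun x => ?_
    calc ‖(u (φ n) - u (φ n')) x‖ₑ
        = ‖(u (φ n) x - L (m, j m x)) - (u (φ n') x - L (m, j m x))‖ₑ := by
          rw [sub_sub_sub_cancel_right, Pi.sub_apply]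
      _ ≤ _ := enorm_sub_le
  obtain ⟨f, hf⟩ := cauchySeq_tendsto_of_complete hcauchy
  obtain ⟨ψ, hψ, hae⟩ := (tendstoInMeasure_of_tendsto_Lp hf).exists_seq_tendsto_ae
  refine ⟨φ ∘ ψ, f, hφ.comp hψ, ?_⟩
  have h2 := ae_all_iff.2 fun n => (hLp n).coeFn_toLp
  filter_upwards [hae, h2] with x hx hx2
  refine hx.congr fun n => ?_
  rw [hx2]
  rfl

end Compactness

/-! ### Passing to the limit in modulars. -/

section Fatou

variable {α : Type*} [MeasurableSpace α] {μ : Measure α} {q : α → ℝ} {a b : ℝ}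

theorem modular_le_of_tendsto (hq : ExponentBounds q a b) {g : ℕ → α → ℝ} {f : α → ℝ}
    (hg : ∀ n, AEMeasurable (g n) μ)
    (hf : ∀ᵐ x ∂μ, Filter.Tendsto (fun n => g n x) Filter.atTop (nhds (f x))) {c : ℝ≥0∞}
    (hc : ∀ᶠ n in Filter.atTop, modular μ q (g n) ≤ c) : modular μ q f ≤ c := by
  have h1 : modular μ q f = ∫⁻ x, Filter.liminf
      (fun n => ENNReal.ofReal (|g n x| ^ q x / q x)) Filter.atTop ∂μ := by
    refine lintegral_congr_ae ?_
    filter_upwards [hf] with x hx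
    exact (ENNReal.tendsto_ofReal
      ((hx.abs.rpow_const (Or.inr (hq.pos x).le)).div_const _)).liminf_eq.symm
  rw [h1]
  refine (lintegral_liminf_le' fun n => ((aemeasurable_abs_rpow hq.measurable (hg n)).div
    hq.measurable.aemeasurable).ennreal_ofReal).trans ?_
  exact Filter.liminf_le_of_frequently_le' hc.frequently

theorem rpow_div_le_min_add {t R Q η : ℝ} (ht : 0 ≤ t) (hR : 0 < R) (hQ : 1 ≤ Q) (hη : 0 ≤ η) :
    t ^ Q / Q ≤ min t R ^ Q / Q + R ^ (-η) * t ^ (Q + η) := by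
  rcases le_total t R with h | h
  · rw [min_eq_left h]
    have : 0 ≤ R ^ (-η) * t ^ (Q + η) := by positivity
    linarith
  · have ht0 : 0 < t := by linarith
    have h1 : 1 ≤ R ^ (-η) * t ^ η := by
      rw [Real.rpow_neg hR.le, inv_mul_eq_div, one_le_div (by positivity)]
      exact Real.rpow_le_rpow hR.le h hη
    have h2 : 0 ≤ min t R ^ Q / Q := by positivity
    calc t ^ Q / Q ≤ t ^ Q := div_le_self (by positivity) hQ
      _ ≤ t ^ Q * (R ^ (-η) * t ^ η) := le_mul_of_one_le_right (by positivity) h1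
      _ = R ^ (-η) * t ^ (Q + η) := by rw [Real.rpow_add ht0]; ring
      _ ≤ _ := by linarith

/-- Truncate at height `R`. Bounded convergence handles the truncated part, and the bound on the
exponent `q + η` makes the rest at most `R^(-η) C` uniformly in `n`; then let `R` tend to infinity.
-/
theorem one_le_modular_of_tendsto [IsFiniteMeasure μ] (hq : ExponentBounds q a b)
    {g : ℕ → α → ℝ} {f : α → ℝ} (hg : ∀ n, AEMeasurable (g n) μ)
    (hf : ∀ᵐ x ∂μ, Filter.Tendsto (fun n => g n x) Filter.atTop (nhds (f x)))
    (h1 : ∀ n, 1 ≤ modular μ q (g n)) {η : ℝ} (hη : 0 < η) {C : ℝ≥0∞} (hC : C ≠ ∞)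
    (hgC : ∀ n, ∫⁻ x, ENNReal.ofReal (|g n x| ^ (q x + η)) ∂μ ≤ C) : 1 ≤ modular μ q f := by
  have key : ∀ R : ℝ, 1 ≤ R → 1 ≤ modular μ q f + ENNReal.ofReal (R ^ (-η)) * C := by
    intro R hR
    have hR0 : 0 < R := by linarith
    have hmeas : ∀ n, AEMeasurable (fun x => ENNReal.ofReal (min |g n x| R ^ q x / q x)) μ :=
      fun n => ((((measurable_norm.comp_aemeasurable (hg n)).min aemeasurable_const).pow
        hq.measurable.aemeasurable).div hq.measurable.aemeasurable).ennreal_ofReal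
    have hlim : Filter.Tendsto (fun n => ∫⁻ x, ENNReal.ofReal (min |g n x| R ^ q x / q x) ∂μ)
        Filter.atTop (nhds (∫⁻ x, ENNReal.ofReal (min |f x| R ^ q x / q x) ∂μ)) := by
      refine tendsto_lintegral_of_dominated_convergence' (fun _ => ENNReal.ofReal (R ^ b)) hmeas
        (fun n => Filter.Eventually.of_forall fun x => ENNReal.ofReal_le_ofReal ?_) ?_ ?_
      · have hq1 : 1 ≤ q x := by linarith [hq.one_lt, hq.le x]
        have hmin : 0 ≤ min |g n x| R := le_min (abs_nonneg _) hR0.le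
        calc min |g n x| R ^ q x / q x ≤ min |g n x| R ^ q x :=
              div_le_self (by positivity) hq1
          _ ≤ R ^ q x := Real.rpow_le_rpow hmin (min_le_right _ _) (by linarith)
          _ ≤ R ^ b := Real.rpow_le_rpow_of_exponent_le hR (hq.ge x)
      · rw [lintegral_const]
        exact ENNReal.mul_ne_top ENNReal.ofReal_ne_top (measure_ne_top _ _)
      · filter_upwards [hf] with x hx
        exact ENNReal.tendsto_ofReal (((hx.abs.min tendsto_const_nhds).rpow_const
          (Or.inr (hq.pos x).le)).div_const _)
    have hle : ∫⁻ x, ENNReal.ofReal (min |f x| R ^ q x / q x) ∂μ ≤ modular μ q f := by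
      refine lintegral_mono fun x => ENNReal.ofReal_le_ofReal ?_
      have := hq.pos x
      have hmin : 0 ≤ min |f x| R := le_min (abs_nonneg _) hR0.le
      gcongr
      exact min_le_left _ _
    refine le_trans ?_ (add_le_add_left hle _)
    refine ge_of_tendsto (hlim.add_const (ENNReal.ofReal (R ^ (-η)) * C))
      (Filter.Eventually.of_forall fun n => (h1 n).trans ?_)
    calc modular μ q (g n) ≤ ∫⁻ x, (ENNReal.ofReal (min |g n x| R ^ q x / q x) +
          ENNReal.ofReal (R ^ (-η)) * ENNReal.ofReal (|g n x| ^ (q x + η))) ∂μ := by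
          refine lintegral_mono fun x => ?_
          have := hq.pos x
          have hmin : 0 ≤ min |g n x| R := le_min (abs_nonneg _) hR0.le
          rw [← ENNReal.ofReal_mul (by positivity), ← ENNReal.ofReal_add (by positivity)
            (by positivity)]
          exact ENNReal.ofReal_le_ofReal (rpow_div_le_min_add (abs_nonneg _) hR0
            (by linarith [hq.one_lt, hq.le x]) hη.le)
      _ = (∫⁻ x, ENNReal.ofReal (min |g n x| R ^ q x / q x) ∂μ) +
          ENNReal.ofReal (R ^ (-η)) * ∫⁻ x, ENNReal.ofReal (|g n x| ^ (q x + η)) ∂μ := by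
          rw [lintegral_add_left' (hmeas n), lintegral_const_mul' _ _ ENNReal.ofReal_ne_top]
      _ ≤ _ := by gcongr; exact hgC n
  have hlim : Filter.Tendsto (fun R : ℝ => modular μ q f + ENNReal.ofReal (R ^ (-η)) * C)
      Filter.atTop (nhds (modular μ q f + 0)) := by
    refine tendsto_const_nhds.add ?_
    have := ENNReal.Tendsto.mul_const (b := C)
      (ENNReal.tendsto_ofReal (tendsto_rpow_neg_atTop hη)) (Or.inr hC)
    simpa using this
  rw [add_zero] at hlim
  refine ge_of_tendsto hlim ?_
  filter_upwards [Filter.eventually_ge_atTop (1 : ℝ)] with R hR using key R hR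

end Fatou

/-! ### Existence of a minimizer by the direct method. -/

section Existence

variable {N : ℕ} {s : ℝ} {p : EuclideanSpace ℝ (Fin N) → EuclideanSpace ℝ (Fin N) → ℝ}
  {Ω : Set (EuclideanSpace ℝ (Fin N))} {a b : ℝ}

theorem lintegral_eq_setLIntegral (hΩ : MeasurableSet Ω)
    {F : EuclideanSpace ℝ (Fin N) → ℝ≥0∞} (hF : ∀ᵐ x, x ∉ Ω → F x = 0) :
    ∫⁻ x, F x = ∫⁻ x in Ω, F x := by
  rw [← lintegral_add_compl F hΩ]
  have h : ∫⁻ x in Ωᶜ, F x = 0 :=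
    lintegral_eq_zero_of_ae_eq_zero ((ae_restrict_iff' hΩ.compl).2 hF)
  rw [h, add_zero]

theorem modular_eq_modular_restrict {q : EuclideanSpace ℝ (Fin N) → ℝ} (hq : ∀ x, 0 < q x)
    (hΩ : MeasurableSet Ω) {u : EuclideanSpace ℝ (Fin N) → ℝ} (hu : ∀ᵐ x, x ∉ Ω → u x = 0) :
    modular volume q u = modular (volume.restrict Ω) q u := by
  refine lintegral_eq_setLIntegral hΩ ?_
  filter_upwards [hu] with x hx h
  rw [hx h]
  simp [Real.zero_rpow (hq x).ne']

theorem exists_isMinimizer (hN : 0 < N) (hs0 : 0 < s) (hs1 : s < 1)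
    (hP : ExponentBounds (fun z : EuclideanSpace ℝ (Fin N) ×
      EuclideanSpace ℝ (Fin N) => p z.1 z.2) a b)
    (hp : Continuous fun z : EuclideanSpace ℝ (Fin N) × EuclideanSpace ℝ (Fin N) => p z.1 z.2)
    (hb : Bornology.IsBounded Ω) (hΩ : MeasurableSet Ω) (hX : ∃ v ∈ X s p Ω, Nontriv v) :
    ∃ u, IsMinimizer s p Ω u := by
  have hP0 : ∀ x y, 0 < p x y := fun x y => hP.pos (x, y)
  have hfin : IsFiniteMeasure (volume.restrict Ω) := ⟨by
    rw [Measure.restrict_apply_univ]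
    exact hb.measure_lt_top⟩
  have hne : (H s p Ω '' {v | v ∈ X s p Ω ∧ Nontriv v}).Nonempty := by
    obtain ⟨v, hv⟩ := hX
    exact ⟨_, v, hv, rfl⟩
  obtain ⟨h, hanti, hlim, hmem⟩ := exists_seq_tendsto_sInf hne bddBelow_H_image
  choose v hv hvh using hmem
  have hK := fun n => K_spec hN hP hb (hv n).1 (hv n).2
  have hk := fun n => k_spec hP hΩ (hv n).1 (hv n).2
  have hh0 : ∀ n, 0 < h n := fun n => by
    rw [← hvh, H]
    exact div_pos (hK n).1 (hk n).1
  -- After this normalization the modular on `Ω` is 1, and `h n` is the scale at which the gradient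
  -- modular is 1.
  set u : ℕ → EuclideanSpace ℝ (Fin N) → ℝ := fun n x => v n x / k p Ω (v n) with hu
  have huX : ∀ n, u n ∈ X s p Ω := fun n => div_mem_X hP (hv n).1 (hk n).1
  have hum : ∀ n, modular (volume.restrict Ω) (fun x => p x x) (u n) = 1 := fun n => (hk n).2
  have hug : ∀ n, modular (fracMeasure N) (fun z => p z.1 z.2)
      (fun z => grad s (u n) z / h n) = 1 := by
    intro n
    rw [← (hK n).2]
    congr 1
    ext z
    rw [hu, grad_div, ← hvh, H]
    have := (hk n).1
    field_simp
  have hul : ∀ n l, h n ≤ l → modular (fracMeasure N) (fun z => p z.1 z.2)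
      (fun z => grad s (u n) z / l) ≤ 1 := fun n l hl =>
    (modular_div_anti hP (hh0 n) hl).trans_eq (hug n)
  have hb0 : 0 < b := by linarith [hP.one_lt, hP.le (0, 0), hP.ge (0, 0)]
  -- The sequence `h` is decreasing, so `h 0` bounds it; the maximum with 1 allows rescaling down to
  -- 1.
  set E : ℝ≥0∞ := ENNReal.ofReal b * ENNReal.ofReal ((max 1 (h 0) / 1) ^ b) with hE
  have huE : ∀ n, energy s p (u n) ≤ E := by
    intro n
    rw [energy_eq_lintegral hP0]
    refine (lintegral_le_modular hP).trans ?_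
    rw [hE]
    gcongr
    have h1 := modular_div_le_of_ge (μ := fracMeasure N) (g := grad s (u n)) hP one_pos
      (le_max_left 1 (h 0))
    simp only [div_one] at h1 ⊢
    refine h1.trans ((mul_le_mul_right (hul n _ ?_) _).trans_eq (mul_one _))
    exact (hanti (Nat.zero_le n)).trans (le_max_right _ _)
  have hEt : E ≠ ∞ := ENNReal.mul_ne_top ENNReal.ofReal_ne_top ENNReal.ofReal_ne_top
  set M : ℝ := volume.real Ω + b with hM
  have hM0 : 0 ≤ M := by positivity
  have huM : ∀ n, ∫⁻ y, ‖u n y‖ₑ ≤ ENNReal.ofReal M := by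
    intro n
    rw [lintegral_eq_setLIntegral hΩ (by
      filter_upwards [(huX n).2.2.2] with x hx hxΩ
      rw [hx hxΩ, enorm_zero])]
    calc ∫⁻ x in Ω, ‖u n x‖ₑ ≤ ∫⁻ x in Ω, (1 + ENNReal.ofReal (|u n x| ^ p x x)) := by
          refine lintegral_mono fun x => ?_
          rw [Real.enorm_eq_ofReal_abs, ← ENNReal.ofReal_one, ← ENNReal.ofReal_add zero_le_one
            (by positivity)]
          apply ENNReal.ofReal_le_ofReal
          have h1 : 1 ≤ p x x := by linarith [hP.one_lt, hP.le (x, x)]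
          simpa using le_add_mul_rpow (c := 1) (abs_nonneg (u n x)) le_rfl h1 h1
      _ = volume Ω + ∫⁻ x in Ω, ENNReal.ofReal (|u n x| ^ p x x) := by
          rw [lintegral_add_left measurable_const, setLIntegral_one]
      _ ≤ volume Ω + ENNReal.ofReal b * 1 := by
          gcongr
          rw [← hum n]
          exact lintegral_le_modular hP.diag
      _ = ENNReal.ofReal M := by
          rw [hM, ENNReal.ofReal_add (by positivity) hb0.le, mul_one, measureReal_def,
            ENNReal.ofReal_toReal hb.measure_lt_top.ne]
  obtain ⟨η, C, hη, hC, hgain⟩ := exists_gain hN hs0 hs1 hP hp hb hΩ hM0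
  obtain ⟨φ, f₀, hφ, hf₀⟩ := exists_subseq_tendsto_ae hs0 hP hb hM0 hEt (fun n => (huX n).1)
    huM huE
  set f : EuclideanSpace ℝ (Fin N) → ℝ := Ω.indicator f₀ with hf
  have hfΩ : ∀ x, x ∉ Ω → f x = 0 := fun x hx => Set.indicator_of_notMem hx _
  have hlimf : ∀ᵐ x, Filter.Tendsto (fun n => u (φ n) x) Filter.atTop (nhds (f x)) := by
    rw [ae_restrict_iff' hΩ] at hf₀
    filter_upwards [hf₀, ae_all_iff.2 fun n => (huX (φ n)).2.2.2] with x h1 h2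
    by_cases hx : x ∈ Ω
    · rw [hf, Set.indicator_of_mem hx]
      exact h1 hx
    · simp only [h2 _ hx, hfΩ x hx]
      exact tendsto_const_nhds
  have hfm : AEMeasurable f volume :=
    aemeasurable_of_tendsto_metrizable_ae Filter.atTop (fun n => (huX (φ n)).1) hlimf
  have hlimg : ∀ᵐ z ∂fracMeasure N,
      Filter.Tendsto (fun n => grad s (u (φ n)) z) Filter.atTop (nhds (grad s f z)) := by
    refine (withDensity_absolutelyContinuous _ _).ae_le ?_
    rw [Measure.volume_eq_prod]
    filter_upwards [Measure.quasiMeasurePreserving_fst.ae hlimf,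
      Measure.quasiMeasurePreserving_snd.ae hlimf] with z h1 h2
    exact (h1.sub h2).div_const _
  -- Only `Λ₁ ≥ 0` is available at this stage, so the bound is taken at every `l > Λ₁`; this avoids
  -- dividing by a possibly zero `Λ₁`.
  have hgrad : ∀ l, Lambda1 s p Ω < l → modular (fracMeasure N) (fun z => p z.1 z.2)
      (fun z => grad s f z / l) ≤ 1 := by
    intro l hl
    refine modular_le_of_tendsto hP (g := fun n z => grad s (u (φ n)) z / l)
      (fun n => (aemeasurable_grad (huX (φ n)).1).div_const l)
      (hlimg.mono fun z hz => hz.div_const l) ?_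
    have h1 : Filter.Tendsto (fun n => h (φ n)) Filter.atTop (nhds (Lambda1 s p Ω)) :=
      hlim.comp hφ.tendsto_atTop
    filter_upwards [h1.eventually (gt_mem_nhds hl)] with n hn
    exact hul _ _ hn.le
  have hL0 : 0 ≤ Lambda1 s p Ω := ge_of_tendsto' hlim fun n => (hh0 n).le
  have hfX : f ∈ X s p Ω := by
    rw [mem_X_iff hP]
    refine ⟨hfm, ?_, ?_, Filter.Eventually.of_forall hfΩ⟩
    · refine ne_top_of_le_ne_top ENNReal.one_ne_top (modular_le_of_tendsto hP.diag
        (fun n => (huX (φ n)).1) hlimf (Filter.Eventually.of_forall fun n => ?_))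
      rw [modular_eq_modular_restrict hP.diag.pos hΩ (huX (φ n)).2.2.2, hum]
    · exact modular_ne_top_of_div hP (l := Lambda1 s p Ω + 1) (by linarith)
        (ne_top_of_le_ne_top ENNReal.one_ne_top (hgrad _ (by linarith)))
  have hf1 : 1 ≤ modular (volume.restrict Ω) (fun x => p x x) f := by
    refine one_le_modular_of_tendsto hP.diag (fun n => (huX (φ n)).1.restrict)
      (ae_restrict_of_ae hlimf) (fun n => (hum (φ n)).ge) hη
      (C := ENNReal.ofReal C * (volume Ω + E)) (ENNReal.mul_ne_top ENNReal.ofReal_ne_top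
        (ENNReal.add_ne_top.2 ⟨hb.measure_lt_top.ne, hEt⟩)) (fun n => ?_)
    refine (hgain _ (huX (φ n)).1 (huM _)).trans ?_
    gcongr
    exact huE _
  have hfn : Nontriv f := by
    intro h0
    have h2 : modular (volume.restrict Ω) (fun x => p x x) f = 0 := by
      refine lintegral_eq_zero_of_ae_eq_zero ?_
      filter_upwards [ae_restrict_of_ae h0] with x hx
      simp [hx, Real.zero_rpow (hP0 x x).ne']
    rw [h2] at hf1
    exact absurd hf1 (by simp)
  refine ⟨f, hfX, hfn, le_antisymm ?_ (Lambda1_le hfX hfn)⟩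
  obtain ⟨hk0, hk1⟩ := k_spec hP hΩ hfX hfn
  obtain ⟨hK0, hK1⟩ := K_spec hN hP hb hfX hfn
  -- The modular of `f` is at least 1, while `k(f) < 1` would bound it by `k(f)^a < 1`.
  have hk : 1 ≤ k p Ω f := by
    by_contra! hlt
    have h2 := modular_div_le_of_le (μ := volume.restrict Ω) (g := f) hP.diag hk0 hlt.le
    simp only [hk1, div_one, mul_one] at h2
    have h3 := hf1.trans h2
    rw [ENNReal.one_le_ofReal] at h3
    exact absurd h3 (not_le.2 (Real.rpow_lt_one hk0.le hlt (by linarith [hP.one_lt])))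
  have hK : K s p f ≤ Lambda1 s p Ω := by
    by_contra! hlt
    obtain ⟨l, hl1, hl2⟩ := exists_between hlt
    have hl0 : 0 < l := hL0.trans_lt hl1
    have h2 := modular_div_le_of_le (μ := fracMeasure N) (g := grad s f) hP hl0 hl2.le
    rw [hK1] at h2
    have h3 := h2.trans ((mul_le_mul_right (hgrad l hl1) _).trans_eq (mul_one _))
    rw [ENNReal.one_le_ofReal] at h3
    exact absurd h3 (not_le.2 (Real.rpow_lt_one (by positivity) ((div_lt_one hK0).2 hl2)
      (by linarith [hP.one_lt])))
  exact (div_le_self hK0.le hk).trans hK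

end Existence

/-! ### A nontrivial element of `X`. -/

section Nonempty

variable {N : ℕ} {s : ℝ} {p : EuclideanSpace ℝ (Fin N) → EuclideanSpace ℝ (Fin N) → ℝ}
  {Ω : Set (EuclideanSpace ℝ (Fin N))} {a b : ℝ}

/-- A radial majorant of the energy kernel of a bounded Lipschitz function. -/
noncomputable def kernelBound (N : ℕ) (s t : ℝ) : ℝ :=
  if t ≤ 1 then t ^ (1 - s - N) else t ^ (-s - N)

theorem measurable_kernelBound : Measurable (kernelBound N s) :=
  Measurable.ite measurableSet_Iic (by fun_prop) (by fun_prop)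

theorem kernelBound_nonneg {t : ℝ} (ht : 0 ≤ t) : 0 ≤ kernelBound N s t := by
  unfold kernelBound
  split_ifs <;> positivity

theorem integrable_kernelBound (hN : 0 < N) (hs0 : 0 < s) (hs1 : s < 1) :
    Integrable fun x : EuclideanSpace ℝ (Fin N) => kernelBound N s ‖x‖ := by
  have : Nontrivial (EuclideanSpace ℝ (Fin N)) := by
    have : Nonempty (Fin N) := ⟨⟨0, hN⟩⟩
    infer_instance
  rw [integrable_fun_norm_addHaar volume (f := kernelBound N s), finrank_euclideanSpace_fin,
    ← Set.Ioc_union_Ioi_eq_Ioi zero_le_one, integrableOn_union]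
  have hpow : ∀ y : ℝ, 0 < y → ∀ c : ℝ, y ^ (N - 1) * y ^ (c - N) = y ^ (c - 1) := by
    intro y hy c
    rw [← Real.rpow_natCast, ← Real.rpow_add hy, Nat.cast_sub hN]
    congr 1
    push_cast
    ring
  constructor
  · have h := (intervalIntegral.intervalIntegrable_rpow' (a := 0) (b := 1) (r := -s)
      (by linarith)).1
    refine h.congr_fun (fun y hy => ?_) measurableSet_Ioc
    rw [smul_eq_mul, kernelBound, if_pos hy.2, hpow y hy.1, sub_sub_cancel_left]
  · have h := integrableOn_Ioi_rpow_of_lt (a := -s - 1) (by linarith) one_pos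
    refine h.congr_fun (fun y hy => ?_) measurableSet_Ioi
    have hy : 1 < y := hy
    rw [smul_eq_mul, kernelBound, if_neg (not_le.2 hy), hpow y (by linarith)]

/-- Use `t ≤ d` at short distance and `t ≤ 1` at long distance. In each regime `P = 1` is the worst
exponent, which removes the dependence on `p`. -/
theorem rpow_div_le_kernelBound (hs0 : 0 < s) (hs1 : s < 1) {t d P : ℝ} (ht : 0 ≤ t) (hd : 0 < d)
    (htd : t ≤ d) (ht1 : t ≤ 1) (hP : 1 ≤ P) :
    t ^ P / d ^ ((N : ℝ) + s * P) ≤ kernelBound N s d := by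
  unfold kernelBound
  split_ifs with h
  · calc t ^ P / d ^ ((N : ℝ) + s * P) ≤ d ^ P / d ^ ((N : ℝ) + s * P) := by gcongr
      _ = d ^ (P - (N + s * P)) := by rw [Real.rpow_sub hd]
      _ ≤ d ^ (1 - s - N) := Real.rpow_le_rpow_of_exponent_ge hd h (by nlinarith)
  · calc t ^ P / d ^ ((N : ℝ) + s * P) ≤ 1 / d ^ ((N : ℝ) + s * P) := by
          gcongr
          exact Real.rpow_le_one ht ht1 (by linarith)
      _ = d ^ (-(N + s * P)) := by rw [Real.rpow_neg hd.le, one_div]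
      _ ≤ d ^ (-s - N) := Real.rpow_le_rpow_of_exponent_le (not_le.1 h).le (by nlinarith)

/-- The cone over the ball of centre `x₀` and radius `r`. -/
noncomputable def cone (x₀ : EuclideanSpace ℝ (Fin N)) (r : ℝ) (x : EuclideanSpace ℝ (Fin N)) : ℝ :=
  max 0 (r - ‖x - x₀‖)

theorem cone_eq_zero {x₀ x : EuclideanSpace ℝ (Fin N)} {r : ℝ} (hx : x ∉ Metric.ball x₀ r) :
    cone x₀ r x = 0 := by
  rw [mem_ball_iff_norm, not_lt] at hx
  exact max_eq_left (by linarith)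

theorem cone_nonneg (x₀ x : EuclideanSpace ℝ (Fin N)) (r : ℝ) : 0 ≤ cone x₀ r x := le_max_left _ _

theorem cone_le {x₀ x : EuclideanSpace ℝ (Fin N)} {r : ℝ} (hr : 0 ≤ r) : cone x₀ r x ≤ r :=
  max_le hr (by linarith [norm_nonneg (x - x₀)])

theorem abs_cone_sub_le (x₀ x y : EuclideanSpace ℝ (Fin N)) (r : ℝ) :
    |cone x₀ r x - cone x₀ r y| ≤ ‖x - y‖ := by
  refine (abs_max_sub_max_le_max _ _ _ _).trans (max_le (by simp) ?_)
  rw [sub_sub_sub_cancel_left, abs_sub_comm]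
  exact (abs_norm_sub_norm_le _ _).trans_eq (by rw [sub_sub_sub_cancel_right])

theorem measurable_cone (x₀ : EuclideanSpace ℝ (Fin N)) (r : ℝ) : Measurable (cone x₀ r) := by
  unfold cone
  fun_prop

theorem energy_cone_integrand_le (hs0 : 0 < s) (hs1 : s < 1) (hP : ∀ x y, 1 ≤ p x y)
    {x₀ : EuclideanSpace ℝ (Fin N)} {r : ℝ} (hr0 : 0 < r) (hr1 : r ≤ 1)
    (z : EuclideanSpace ℝ (Fin N) × EuclideanSpace ℝ (Fin N)) :
    ENNReal.ofReal (|cone x₀ r z.1 - cone x₀ r z.2| ^ p z.1 z.2 /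
      ‖z.1 - z.2‖ ^ ((N : ℝ) + s * p z.1 z.2)) ≤
      (Metric.ball x₀ r).indicator 1 z.1 * ENNReal.ofReal (kernelBound N s ‖z.1 - z.2‖) +
      (Metric.ball x₀ r).indicator 1 z.2 * ENNReal.ofReal (kernelBound N s ‖z.1 - z.2‖) := by
  have hp0 : p z.1 z.2 ≠ 0 := by linarith [hP z.1 z.2]
  rcases eq_or_ne z.1 z.2 with h | h
  · rw [show cone x₀ r z.1 = cone x₀ r z.2 by rw [h], sub_self, abs_zero, Real.zero_rpow hp0]
    simp
  have key : ENNReal.ofReal (|cone x₀ r z.1 - cone x₀ r z.2| ^ p z.1 z.2 /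
      ‖z.1 - z.2‖ ^ ((N : ℝ) + s * p z.1 z.2)) ≤
        ENNReal.ofReal (kernelBound N s ‖z.1 - z.2‖) := by
    refine ENNReal.ofReal_le_ofReal (rpow_div_le_kernelBound hs0 hs1 (abs_nonneg _)
      (norm_pos_iff.2 (sub_ne_zero.2 h)) (abs_cone_sub_le _ _ _ _) ?_ (hP _ _))
    have h1 := cone_nonneg x₀ z.1 r
    have h2 := cone_nonneg x₀ z.2 r
    have h3 := cone_le (x₀ := x₀) (x := z.1) hr0.le
    have h4 := cone_le (x₀ := x₀) (x := z.2) hr0.le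
    rw [abs_le]
    constructor <;> linarith
  by_cases h1 : z.1 ∈ Metric.ball x₀ r
  · rw [Set.indicator_of_mem h1, Pi.one_apply, one_mul]
    exact key.trans le_self_add
  · by_cases h2 : z.2 ∈ Metric.ball x₀ r
    · rw [Set.indicator_of_mem h2, Pi.one_apply, one_mul]
      exact key.trans le_add_self
    · rw [cone_eq_zero h1, cone_eq_zero h2, sub_zero, abs_zero, Real.zero_rpow hp0]
      simp

/-- The integrand vanishes unless one of the two points lies in the ball, so Tonelli and translation
invariance bound the energy by twice the volume of the ball times the integral of the radial
majorant. -/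
theorem energy_cone_lt_top (hN : 0 < N) (hs0 : 0 < s) (hs1 : s < 1) (hP : ∀ x y, 1 ≤ p x y)
    (x₀ : EuclideanSpace ℝ (Fin N)) {r : ℝ} (hr0 : 0 < r) (hr1 : r ≤ 1) :
    energy s p (cone x₀ r) < ∞ := by
  set G : EuclideanSpace ℝ (Fin N) → ℝ≥0∞ := fun x => ENNReal.ofReal (kernelBound N s ‖x‖) with hG
  have hGm : Measurable G := (measurable_kernelBound.comp measurable_norm).ennreal_ofReal
  have hGt : ∫⁻ x, G x < ∞ := by
    have h := (integrable_kernelBound hN hs0 hs1).2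
    rwa [hasFiniteIntegral_iff_ofReal (Filter.Eventually.of_forall fun x =>
      kernelBound_nonneg (norm_nonneg _))] at h
  set B := Metric.ball x₀ r with hB
  have hBm : Measurable (B.indicator (1 : EuclideanSpace ℝ (Fin N) → ℝ≥0∞)) :=
    measurable_one.indicator Metric.isOpen_ball.measurableSet
  have hBi : ∫⁻ x, B.indicator (1 : EuclideanSpace ℝ (Fin N) → ℝ≥0∞) x = volume B :=
    lintegral_indicator_one Metric.isOpen_ball.measurableSet
  have hGd : Measurable fun z : EuclideanSpace ℝ (Fin N) × EuclideanSpace ℝ (Fin N) =>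
      G (z.1 - z.2) := hGm.comp (measurable_fst.sub measurable_snd)
  have m1 : Measurable fun z : EuclideanSpace ℝ (Fin N) × EuclideanSpace ℝ (Fin N) =>
      B.indicator 1 z.1 * G (z.1 - z.2) := (hBm.comp measurable_fst).mul hGd
  have m2 : Measurable fun z : EuclideanSpace ℝ (Fin N) × EuclideanSpace ℝ (Fin N) =>
      B.indicator 1 z.2 * G (z.1 - z.2) := (hBm.comp measurable_snd).mul hGd
  have i1 : ∫⁻ z : EuclideanSpace ℝ (Fin N) × EuclideanSpace ℝ (Fin N),
      B.indicator 1 z.1 * G (z.1 - z.2) = volume B * ∫⁻ x, G x := by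
    rw [Measure.volume_eq_prod, lintegral_prod _ m1.aemeasurable, ← hBi,
      ← lintegral_mul_const _ hBm]
    refine lintegral_congr fun x => ?_
    have : Measurable fun y => G (x - y) := hGm.comp (measurable_const.sub measurable_id)
    dsimp only
    rw [lintegral_const_mul _ this, lintegral_sub_left_eq_self G x]
  have i2 : ∫⁻ z : EuclideanSpace ℝ (Fin N) × EuclideanSpace ℝ (Fin N),
      B.indicator 1 z.2 * G (z.1 - z.2) = volume B * ∫⁻ x, G x := by
    rw [Measure.volume_eq_prod, lintegral_prod_symm _ m2.aemeasurable, ← hBi,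
      ← lintegral_mul_const _ hBm]
    refine lintegral_congr fun y => ?_
    have : Measurable fun x => G (x - y) := hGm.comp (measurable_id.sub measurable_const)
    dsimp only
    rw [lintegral_const_mul _ this, lintegral_sub_right_eq_self G y]
  calc energy s p (cone x₀ r)
      ≤ ∫⁻ z : EuclideanSpace ℝ (Fin N) × EuclideanSpace ℝ (Fin N),
        (B.indicator 1 z.1 * G (z.1 - z.2) + B.indicator 1 z.2 * G (z.1 - z.2)) :=
        lintegral_mono fun z => energy_cone_integrand_le hs0 hs1 hP hr0 hr1 z
    _ = (volume B * ∫⁻ x, G x) + volume B * ∫⁻ x, G x := by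
        rw [lintegral_add_left m1, i1, i2]
    _ < ∞ := by
        have := ENNReal.mul_lt_top (measure_ball_lt_top (x := x₀) (r := r) (μ := volume)) hGt
        exact ENNReal.add_lt_top.2 ⟨this, this⟩

theorem exists_mem_X_nontriv (hN : 0 < N) (hs0 : 0 < s) (hs1 : s < 1) (hP : ∀ x y, 1 ≤ p x y)
    (hΩ : IsOpen Ω) (hne : Ω.Nonempty) : ∃ v ∈ X s p Ω, Nontriv v := by
  obtain ⟨x₀, hx₀⟩ := hne
  obtain ⟨ε, hε, hsub⟩ := Metric.isOpen_iff.1 hΩ x₀ hx₀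
  set r := min ε 1 with hr
  have hr0 : 0 < r := lt_min hε one_pos
  have hr1 : r ≤ 1 := min_le_right _ _
  refine ⟨cone x₀ r, ⟨(measurable_cone x₀ r).aemeasurable, ?_,
    energy_cone_lt_top hN hs0 hs1 hP x₀ hr0 hr1, Filter.Eventually.of_forall fun x hx =>
      cone_eq_zero fun h => hx (hsub (Metric.ball_subset_ball (min_le_left _ _) h))⟩, fun h0 => ?_⟩
  · calc ∫⁻ x, ENNReal.ofReal (|cone x₀ r x| ^ p x x)
        ≤ ∫⁻ x, (Metric.ball x₀ r).indicator 1 x := by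
          refine lintegral_mono fun x => ?_
          have hp := hP x x
          by_cases hx : x ∈ Metric.ball x₀ r
          · rw [Set.indicator_of_mem hx, Pi.one_apply, ENNReal.ofReal_le_one]
            refine Real.rpow_le_one (abs_nonneg _) ?_ (by linarith)
            rw [abs_of_nonneg (cone_nonneg _ _ _)]
            exact (cone_le hr0.le).trans hr1
          · rw [cone_eq_zero hx, abs_zero, Real.zero_rpow (by linarith)]
            simp
      _ = volume (Metric.ball x₀ r) := lintegral_indicator_one Metric.isOpen_ball.measurableSet
      _ < ∞ := measure_ball_lt_top
  · refine (Metric.measure_ball_pos volume x₀ hr0).ne' ?_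
    rw [← nonpos_iff_eq_zero, ← show volume {x | ¬ cone x₀ r x = (0 : EuclideanSpace ℝ (Fin N) → ℝ) x} = 0 from h0]
    refine measure_mono fun x hx hc => ?_
    have hx : ‖x - x₀‖ < r := mem_ball_iff_norm.1 hx
    have h1 : r - ‖x - x₀‖ ≤ cone x₀ r x := le_max_right _ _
    rw [hc, Pi.zero_apply] at h1
    linarith

/-- For `N = 0` the upper bound `N / s` is 0, which is incompatible with `p > 1`. -/
theorem IsAdmissibleExponent.dim_pos (hp : IsAdmissibleExponent s p) : 0 < N := by
  rcases Nat.eq_zero_or_pos N with rfl | h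
  · obtain ⟨a, ha, ha'⟩ := hp.one_lt_inf
    obtain ⟨b, hb, hb'⟩ := hp.sup_lt
    rw [Nat.cast_zero, zero_div] at hb
    linarith [ha' 0 0, hb' 0 0]
  · exact h

end Nonempty

end FracEigen

theorem mainTheorem10 (N : ℕ) (s : ℝ) (hs0 : 0 < s) (hs1 : s < 1)
    (p : EuclideanSpace ℝ (Fin N) → EuclideanSpace ℝ (Fin N) → ℝ)
    (hp : FracEigen.IsAdmissibleExponent s p)
    (Ω : Set (EuclideanSpace ℝ (Fin N))) (hΩ : FracEigen.IsBoundedLipschitzDomain Ω) :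
    (∃ u, FracEigen.IsMinimizer s p Ω u) ∧
    (∀ u, FracEigen.IsMinimizer s p Ω u →
      FracEigen.IsEigenpair s p Ω (FracEigen.Lambda1 s p Ω) u) ∧
    (∀ Λ v, FracEigen.IsEigenpair s p Ω Λ v →
      Λ = FracEigen.K s p v / FracEigen.k p Ω v ∧ FracEigen.Lambda1 s p Ω ≤ Λ) ∧
    IsLeast {Λ | FracEigen.IsEigenvalue s p Ω Λ} (FracEigen.Lambda1 s p Ω) := by
  obtain ⟨a, b, hP⟩ := hp.exponentBounds
  have hN := hp.dim_pos
  have hm := hΩ.isOpen.measurableSet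
  have hmin : ∃ u, FracEigen.IsMinimizer s p Ω u :=
    FracEigen.exists_isMinimizer hN hs0 hs1 hP hp.continuous hΩ.isBounded hm
      (FracEigen.exists_mem_X_nontriv hN hs0 hs1
        (fun x y => by linarith [hP.one_lt, hP.le (x, y)]) hΩ.isOpen hΩ.nonempty)
  have heig : ∀ u, FracEigen.IsMinimizer s p Ω u →
      FracEigen.IsEigenpair s p Ω (FracEigen.Lambda1 s p Ω) u := fun u hu =>
    hu.isEigenpair hN hP hΩ.isBounded hm
  have hlow : ∀ Λ v, FracEigen.IsEigenpair s p Ω Λ v →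
      Λ = FracEigen.K s p v / FracEigen.k p Ω v ∧ FracEigen.Lambda1 s p Ω ≤ Λ := fun Λ v hv => by
    have h := hv.eq_div hN hP hΩ.isBounded hm
    exact ⟨h, (FracEigen.Lambda1_le hv.mem hv.nontriv).trans_eq h.symm⟩
  refine ⟨hmin, heig, hlow, ?_, fun Λ hΛ => ?_⟩
  · obtain ⟨u, hu⟩ := hmin
    exact ⟨u, heig u hu⟩
  · obtain ⟨v, hv⟩ := hΛ
    exact (hlow Λ v hv).2
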